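/- Let $l\ge 0$ and let $\mathbf d=(d_1,\dots,d_l)$ be a tuple of positive integers; put $n=d_1+\cdots+d_l$ and $\mathbf a=(n,d_1,\dots,d_l)$. For a tuple $\mathbf n=(n_1,\dots,n_r)$ of nonnegative integers and a field $K$ let $\mathrm{GL}_{\mathbf n}(K)=\prod_{i=1}^r \mathrm{GL}(K^{n_i})$. **Types.** An $\mathbf n$-pretype is a triple $(Q,(e_j)_{j\in Q},(\lambda^{ij})_{1\le i\le r,\,j\in Q})$, where $Q$ is a finite set, the $e_j$ are positive integers and the $\lambda^{ij}$ are (possibly empty) partitions, such that $\sum_{j\in Q} e_j|\lambda^{ij}|=n_i$ for every $i$, and for every $j\in Q$ some $\lambda^{ij}$ is non-empty. Two pretypes are isomorphic if a bijection of their index sets preserves all $e_j$ and $\lambda^{ij}$; an $\mathbf n$-type is an isomorphism class of $\mathbf n$-pretypes. An element $\mathbf g=(g_1,\dots,g_r)\in\mathrm{GL}_{\mathbf n}(K)$ is of type $[Q,(e_j),(\lambda^{ij})]$ if there are distinct monic irreducible polynomials $f_j\in K[X]$ $(j\in Q)$ with $\deg f_j=e_j$ such that, for every $i$, the $K[X]$-module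 $K^{n_i}$ on which $X$ acts as $g_i$ is isomorphic to $\bigoplus_{j\in Q}\bigoplus_{k} K[X]/(f_j^{\lambda^{ij}_k})$. A conjugacy class of $\mathrm{GL}_{\mathbf n}(K)$ is of type $\mathcal T$ if its elements are. **Uniform families.** Suppose that a subgroup $H(K)\le\mathrm{GL}_{\mathbf n}(K)$ is given for every finite field $K$. The family $H$ is uniform if for every $\mathbf n$-type $\mathcal T$ there is a polynomial $P_{\mathcal T}\in\mathbb Q[X]$ such that, for every finite field $K$ with $q$ elements and every conjugacy class $C$ of $\mathrm{GL}_{\mathbf n}(K)$ of type $\mathcal T$, $|C\cap H(K)|=P_{\mathcal T}(q)$; thus $|C\cap H(K)|$ depends only on $\mathcal T$ and $q$ and, for fixed $\mathcal T$, is a polynomial function of $q$. **Proposition.** For every finite field $K$ choose a flag $0=U_0\le U_1\le\cdots\le U_l=V$ in $V=K^n$ with $\dim(U_i/U_{i-1})=d_i$ for $1\le i\le l$, and linear isomorphisms $U_i/U_{i-1}\cong K^{d_i}$, by which $\mathrm{GL}(V)\times\prod_{i=1}^l\mathrm{GL}(U_i/U_{i-1})$ is identified with $\mathrm{GL}_{\mathbf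 a}(K)$. Let $\mathcal J_{\mathbf d}(K)\le\mathrm{GL}_{\mathbf a}(K)$ be the image of the parabolic subgroup $\{g\in\mathrm{GL}(V): g(U_i)\subseteq U_i \text{ for all } i\}$ under the natural embedding $g\mapsto(g,\,g|_{U_1/U_0},\dots,g|_{U_l/U_{l-1}})$. Then $\mathcal J_{\mathbf d}$ is a uniform family of subgroups of $\mathrm{GL}_{\mathbf a}$. -/

import Mathlib

open Polynomial DirectSum

universe u

/-- A partition of an arbitrary nonnegative integer: the first component is the size `|lam|`. -/
abbrev IntPartition : Type := Σ m : ℕ, m.Partition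

/-- The `K[X]`-module `M_lam(f)`, the direct sum of `K[X] / (f ^ k)` over the parts `k` of `lam`
(with multiplicity). -/
abbrev PartitionModule {K : Type u} [Field K] (lam : IntPartition) (f : K[X]) : Type u :=
  ⨁ k : lam.2.parts, K[X] ⧸ Ideal.span {f ^ k.1}

/-- `GL_n(K) = GL_{n_1}(K) × ⋯ × GL_{n_r}(K)`, where `GL_m(K) = GL(K^m)`. -/
abbrev GLTuple {r : ℕ} (n : Fin r → ℕ) (K : Type u) [Field K] : Type u :=
  ∀ i : Fin r, LinearMap.GeneralLinearGroup K (Fin (n i) → K)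

/-- An `n`-pretype `(Q, deg, part)`. -/
structure Pretype {r : ℕ} (n : Fin r → ℕ) where
  Q : Type
  [fintypeQ : Fintype Q]
  deg : Q → ℕ
  deg_pos : ∀ j, 0 < deg j
  part : Fin r → Q → IntPartition
  sum_eq : ∀ i, ∑ j, deg j * (part i j).1 = n i
  exists_nonempty : ∀ j, ∃ i, (part i j).1 ≠ 0

attribute [instance] Pretype.fintypeQ

/-- Two pretypes are isomorphic if a bijection of the index sets respects degrees and
partitions. -/
def Pretype.Iso {r : ℕ} {n : Fin r → ℕ} (P P' : Pretype n) : Prop :=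
  ∃ f : P.Q ≃ P'.Q, (∀ j, P'.deg (f j) = P.deg j) ∧ ∀ i j, P'.part i (f j) = P.part i j

instance Pretype.setoid {r : ℕ} (n : Fin r → ℕ) : Setoid (Pretype n) where
  r := Pretype.Iso
  iseqv :=
    { refl := fun _ => ⟨Equiv.refl _, fun _ => rfl, fun _ _ => rfl⟩
      symm := by
        rintro P P' ⟨f, h1, h2⟩
        refine ⟨f.symm, fun j => ?_, fun i j => ?_⟩
        · rw [← h1, f.apply_symm_apply]
        · rw [← h2, f.apply_symm_apply]
      trans := by
        rintro P P' P'' ⟨f, h1, h2⟩ ⟨g, k1, k2⟩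
        exact ⟨f.trans g, fun j => by simp [k1, h1], fun i j => by simp [k2, h2]⟩ }

/-- An `n`-type is an isomorphism class of `n`-pretypes. -/
def NType {r : ℕ} (n : Fin r → ℕ) : Type 1 := Quotient (Pretype.setoid n)

/-- `P` records the decomposition of `g`: there are distinct monic irreducible polynomials `F j`
of degrees `deg j` such that, for every `i`, the `K[X]`-module given by `g i` is isomorphic to
the direct sum of the modules `M_{part i j}(F j)`. -/
def Pretype.Describes {r : ℕ} {n : Fin r → ℕ} {K : Type u} [Field K] (P : Pretype n)
    (g : GLTuple n K) : Prop :=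
  ∃ F : P.Q → K[X], Function.Injective F ∧
    (∀ j, (F j).Monic ∧ Irreducible (F j) ∧ (F j).natDegree = P.deg j) ∧
    ∀ i, Nonempty (Module.AEval' (g i : Module.End K (Fin (n i) → K)) ≃ₗ[K[X]]
      ⨁ j, PartitionModule (P.part i j) (F j))

/-- `g` is of type `T`. -/
def HasType {r : ℕ} {n : Fin r → ℕ} {K : Type u} [Field K] (g : GLTuple n K) (T : NType n) :
    Prop :=
  ∃ P : Pretype n, Quotient.mk (Pretype.setoid n) P = T ∧ P.Describes g

/-- `C` is a conjugacy class of type `T`. -/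
def IsClassOfType {r : ℕ} {n : Fin r → ℕ} {K : Type u} [Field K]
    (C : ConjClasses (GLTuple n K)) (T : NType n) : Prop :=
  ∃ g ∈ C.carrier, HasType g T

/-- A family of subgroups `H K` of `GL_n(K)`, one for each finite field `K`, is uniform if for
every type `T` there is a polynomial `P` with rational coefficients such that
`|C ∩ H K| = P(|K|)` for all finite fields `K` and all classes `C` of type `T` in `GL_n(K)`. -/
def IsUniformFamily {r : ℕ} (n : Fin r → ℕ)
    (H : ∀ (K : Type u) [Field K] [Finite K], Subgroup (GLTuple n K)) : Prop :=
  ∀ T : NType n, ∃ P : ℚ[X], ∀ (K : Type u) [Field K] [Finite K]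
    (C : ConjClasses (GLTuple n K)), IsClassOfType C T →
      ((C.carrier ∩ (H K : Set (GLTuple n K))).ncard : ℚ) = P.eval (Nat.card K : ℚ)

/-- The subgroup of all `f ∈ GL(V)` with `f(U i) ⊆ U i` for all `i`. -/
def parabolic {K V ι : Type*} [Field K] [AddCommGroup V] [Module K V] [FiniteDimensional K V]
    (U : ι → Submodule K V) : Subgroup (LinearMap.GeneralLinearGroup K V) where
  carrier := {f | ∀ i, ∀ v ∈ U i, (f : Module.End K V) v ∈ U i}
  one_mem' := fun _ _ hv => hv
  mul_mem' := fun ha hb i v hv => ha i _ (hb i v hv)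
  inv_mem' := by
    intro f hf i v hv
    have hinj : Function.Injective (f : Module.End K V) :=
      (LinearMap.GeneralLinearGroup.toLinearEquiv f).injective
    have hle : (U i).map (f : Module.End K V) ≤ U i := by
      rintro _ ⟨w, hw, rfl⟩
      exact hf i w hw
    have heq := Submodule.eq_of_le_of_finrank_eq hle
      (LinearEquiv.finrank_eq (Submodule.equivMapOfInjective _ hinj (U i))).symm
    rw [← heq] at hv
    obtain ⟨w, hw, rfl⟩ := hv
    have : ((f⁻¹ : LinearMap.GeneralLinearGroup K V) : Module.End K V)
        ((f : Module.End K V) w) = w := by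
      rw [← Module.End.mul_apply, Units.inv_mul, Module.End.one_apply]
    rw [this]
    exact hw

/-- The set of flags `0 = U_0 ≤ U_1 ≤ ⋯ ≤ U_l = V` with `dim (U_i / U_{i-1}) = d_i`. -/
structure DimFlag (K V : Type*) [Field K] [AddCommGroup V] [Module K V] {l : ℕ}
    (d : Fin l → ℕ) where
  U : Fin (l + 1) → Submodule K V
  bot : U 0 = ⊥
  top : U (Fin.last l) = ⊤
  le : ∀ i : Fin l, U i.castSucc ≤ U i.succ
  finrank_step : ∀ i : Fin l,
    Module.finrank K (U i.succ ⧸ (U i.castSucc).submoduleOf (U i.succ)) = d i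

namespace DimFlag

variable {K V : Type*} [Field K] [AddCommGroup V] [Module K V] {l : ℕ} {d : Fin l → ℕ}

/-- The successive quotient `U_i / U_{i-1}`. -/
abbrev Step (𝓤 : DimFlag K V d) (i : Fin l) : Type _ :=
  𝓤.U i.succ ⧸ (𝓤.U i.castSucc).submoduleOf (𝓤.U i.succ)

/-- The action of the parabolic subgroup on `U_i / U_{i-1}`. -/
def stepAction [FiniteDimensional K V] (𝓤 : DimFlag K V d) (i : Fin l) :
    parabolic 𝓤.U →* LinearMap.GeneralLinearGroup K (𝓤.Step i) :=
  MonoidHom.toHomUnits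
    { toFun := fun f => Submodule.mapQ _ _
        ((f.1 : Module.End K V).restrict (f.2 i.succ)) (fun v hv => f.2 i.castSucc v.1 hv)
      map_one' := by
        ext v
        rfl
      map_mul' := fun f g => by
        ext v
        rfl }

end DimFlag

/-- The tuple `a = (d_1 + ⋯ + d_l, d_1, …, d_l)`. -/
abbrev flagDims {l : ℕ} (d : Fin l → ℕ) : Fin (l + 1) → ℕ := Fin.cons (∑ i, d i) d

namespace DimFlag

variable {K : Type u} [Field K] {l : ℕ} {d : Fin l → ℕ}

/-- The embedding of the parabolic subgroup of a flag in `V = K^n`, `n = d_1 + ⋯ + d_l`, into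
`GL(V) × ∏ GL(U_i / U_{i-1})`, the latter group being identified with `GL_a(K)` through
coordinates `e i` on the quotients `U_i / U_{i-1}`. -/
noncomputable def embedding (𝓤 : DimFlag K (Fin (∑ i, d i) → K) d)
    (e : ∀ i, 𝓤.Step i ≃ₗ[K] (Fin (d i) → K)) :
    parabolic 𝓤.U →* GLTuple (flagDims d) K :=
  MonoidHom.pi (Fin.cases
    (motive := fun i => parabolic 𝓤.U →*
      LinearMap.GeneralLinearGroup K (Fin (flagDims d i) → K))
    (parabolic 𝓤.U).subtype
    (fun i => (LinearMap.GeneralLinearGroup.congrLinearEquiv (e i)).toMonoidHom.comp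
      (𝓤.stepAction i)))

/-- The image of the parabolic subgroup in `GL_a(K)`. -/
noncomputable def imageJ (𝓤 : DimFlag K (Fin (∑ i, d i) → K) d)
    (e : ∀ i, 𝓤.Step i ≃ₗ[K] (Fin (d i) → K)) : Subgroup (GLTuple (flagDims d) K) :=
  (𝓤.embedding e).range

end DimFlag

/-! Let `M` be `K^n` with `X` acting as `g 0`. A parabolic element has image conjugate to `g`
exactly when it is similar to `g 0` and induces on each quotient of the flag `U` a map similar to
the matching component of `g`. So the task is to count the endomorphisms `p` of `V` that are similar
to `g 0`, preserve `U` and have prescribed types on its quotients.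

Count the linear isomorphisms `h : V ≃ M` carrying `U` to a flag of submodules of `M` with these
types. Sorted by the image flag, their number is #(typed flags of `M`) · |Par|, since linear groups
are transitive on flags (`card_carriesToTypedFlag`). Sorted by the endomorphism of `V` that
corresponds to `X`, it is #`p` · |Aut `M`| (`card_conjugates_mul_card_aut`). When `X` acts as zero
there is just one `p`, so the same identity evaluates |Par|. It remains to see that flag numbers and
automorphism numbers are rational functions of `q` depending only on types.

The type of `B / A` is the family of dimensions of `F j ^ i • (B / A)` (`relType`). Flags are
counted step by step with Hall numbers (`hallRational`, `card_chains_rational`). For these, count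
pairs `N₁ ≤ N` in which `N₁` is killed by `F j` and has the dimension of the `F j`-socle of a module
of type `t`, while `N / N₁` has the type of `t` modulo that socle. From `N₁` one meets Hall numbers
of smaller dimension. From `N`, type `t` contributes exactly once, and any other type that
contributes has a larger socle and is known by induction. The `N₁` themselves are counted by linear
algebra over `K[X] / (F j)` (`card_elementary_submodules`).

Automorphisms are the injective endomorphisms. The number of all homomorphisms is a power of `q`
(`homLaw`); those with nonzero kernel are injections of proper quotients, which Hall numbers count
(`card_injections_rational`).

Finally, a rational function with integral values at infinitely many natural numbers is a polynomial
(`exists_polynomial_of_integral_quotient`). -/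

open scoped Pointwise

/-! ### Rational functions of `q` -/

/-- A function of `q` that is given, for `q ≥ 2`, by a rational function without poles there. -/
def IsRational (c : ℕ → ℚ) : Prop :=
  ∃ A B : ℚ[X], ∀ q : ℕ, 2 ≤ q → B.eval (q : ℚ) ≠ 0 ∧ c q * B.eval (q : ℚ) = A.eval (q : ℚ)

namespace IsRational

variable {c c' : ℕ → ℚ}

theorem const (a : ℚ) : IsRational fun _ => a :=
  ⟨C a, 1, fun q _ => by simp⟩

theorem pow_self (k : ℕ) : IsRational fun q => (q : ℚ) ^ k :=
  ⟨X ^ k, 1, fun q _ => by simp⟩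

theorem add (h : IsRational c) (h' : IsRational c') : IsRational fun q => c q + c' q := by
  obtain ⟨A, B, hAB⟩ := h
  obtain ⟨A', B', hAB'⟩ := h'
  refine ⟨A * B' + A' * B, B * B', fun q hq => ?_⟩
  obtain ⟨h1, h2⟩ := hAB q hq
  obtain ⟨h1', h2'⟩ := hAB' q hq
  refine ⟨by simp [h1, h1'], ?_⟩
  simp only [eval_add, eval_mul, ← h2, ← h2']
  ring

theorem mul (h : IsRational c) (h' : IsRational c') : IsRational fun q => c q * c' q := by
  obtain ⟨A, B, hAB⟩ := h
  obtain ⟨A', B', hAB'⟩ := h'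
  refine ⟨A * A', B * B', fun q hq => ?_⟩
  obtain ⟨h1, h2⟩ := hAB q hq
  obtain ⟨h1', h2'⟩ := hAB' q hq
  refine ⟨by simp [h1, h1'], ?_⟩
  simp only [eval_mul, ← h2, ← h2']
  ring

theorem neg (h : IsRational c) : IsRational fun q => -c q := by
  simpa using (const (-1)).mul h

theorem sub (h : IsRational c) (h' : IsRational c') : IsRational fun q => c q - c' q := by
  simpa [sub_eq_add_neg] using h.add h'.neg

theorem div (h : IsRational c) (h' : IsRational c') (hne : ∀ q, 2 ≤ q → c' q ≠ 0) :
    IsRational fun q => c q / c' q := by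
  obtain ⟨A, B, hAB⟩ := h
  obtain ⟨A', B', hAB'⟩ := h'
  refine ⟨A * B', B * A', fun q hq => ?_⟩
  obtain ⟨h1, h2⟩ := hAB q hq
  obtain ⟨h1', h2'⟩ := hAB' q hq
  have h3 := hne q hq
  refine ⟨by simp [h1, h1', h3, ← h2'], ?_⟩
  simp only [eval_mul, ← h2, ← h2']
  field_simp

theorem sum {ι : Type*} (s : Finset ι) {c : ι → ℕ → ℚ} (h : ∀ i ∈ s, IsRational (c i)) :
    IsRational fun q => ∑ i ∈ s, c i q := by
  classical
  induction s using Finset.induction_on with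
  | empty => simpa using const 0
  | insert a s ha ih =>
    simp only [Finset.sum_insert ha]
    exact (h a (by simp)).add (ih fun i hi => h i (by simp [hi]))

end IsRational

/-- A polynomial that takes integral values infinitely often after division by another one
agrees with a polynomial multiple of it. -/
theorem exists_polynomial_of_integral_quotient (A B : ℚ[X]) (S : Set ℕ)
    (h : ∀ q ∈ S, B.eval (q : ℚ) ≠ 0 ∧ ∃ z : ℤ, (z : ℚ) * B.eval (q : ℚ) = A.eval (q : ℚ)) :
    ∃ P : ℚ[X], ∀ q ∈ S, P.eval (q : ℚ) * B.eval (q : ℚ) = A.eval (q : ℚ) := by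
  -- Interpolation settles a finite `S`, so it need not be known over how many fields a type occurs.
  by_cases hS : S.Finite
  · classical
    refine ⟨Lagrange.interpolate hS.toFinset (fun q : ℕ => (q : ℚ))
      (fun q => A.eval (q : ℚ) / B.eval (q : ℚ)), fun q hq => ?_⟩
    rw [Lagrange.eval_interpolate_at_node _ (Nat.cast_injective.injOn) (by simpa using hq)]
    exact div_mul_cancel₀ _ (h q hq).1
  have hS : S.Infinite := hS
  obtain ⟨q₀, hq₀⟩ := hS.nonempty
  have hB : B ≠ 0 := by
    rintro rfl
    exact (h q₀ hq₀).1 (by simp)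
  -- `D` clears the denominators of `A / B`, so on `S` the number `D * (A % B) / B` is an integer.
  -- It tends to zero, hence vanishes at all large `q ∈ S`, and `A % B` has infinitely many roots.
  obtain ⟨D, hDmem, hD⟩ := IsLocalization.integerNormalization_spec (nonZeroDivisors ℤ) (A / B)
  have hD0 : (D : ℚ) ≠ 0 := by
    exact_mod_cast nonZeroDivisors.ne_zero hDmem
  have hint : ∀ q : ℕ, ∃ z : ℤ, (D : ℚ) * (A / B).eval (q : ℚ) = z := by
    intro q
    refine ⟨(IsLocalization.integerNormalization (nonZeroDivisors ℤ) (A / B)).eval (q : ℤ), ?_⟩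
    have := congrArg (eval (((q : ℤ) : ℚ))) hD
    rw [show algebraMap ℤ ℚ = Int.castRingHom ℚ from rfl, eval_intCast_map] at this
    simpa using this.symm
  have hdecomp : ∀ q : ℕ, A.eval (q : ℚ) =
      B.eval (q : ℚ) * (A / B).eval (q : ℚ) + (A % B).eval (q : ℚ) := by
    intro q
    rw [← eval_mul, ← eval_add, EuclideanDomain.div_add_mod]
  have hlim : Filter.Tendsto (fun q : ℕ => (A % B).eval (q : ℚ) / B.eval (q : ℚ))
      Filter.atTop (nhds 0) :=
    (Polynomial.div_tendsto_atTop_zero_of_degree_lt _ _ (EuclideanDomain.mod_lt A hB)).comp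
      tendsto_natCast_atTop_atTop
  have hzero : A % B = 0 := by
    have hev := hlim.abs.eventually_lt_const
      (show |(0 : ℚ)| < |(D : ℚ)|⁻¹ by simpa using hD0)
    obtain ⟨N, hN⟩ := Filter.eventually_atTop.mp hev
    have hinf : (S ∩ Set.Ici N).Infinite := by
      refine (hS.sdiff (Set.finite_Iio N)).mono fun q hq => ⟨hq.1, ?_⟩
      simpa using hq.2
    have hroot : ∀ q ∈ S ∩ Set.Ici N, (A % B).eval (q : ℚ) = 0 := by
      rintro q ⟨hq, hqN⟩
      obtain ⟨hb, z, hz⟩ := h q hq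
      obtain ⟨w, hw⟩ := hint q
      have h1 := hN q hqN
      have h2 : (D : ℚ) * ((A % B).eval (q : ℚ) / B.eval (q : ℚ)) = ((D * z - w : ℤ) : ℚ) := by
        have h3 := hdecomp q
        rw [← hz] at h3
        push_cast
        rw [← hw]
        field_simp
        linear_combination -h3
      have h3 : |((D * z - w : ℤ) : ℚ)| < 1 := by
        rw [← h2, abs_mul]
        calc _ < |(D : ℚ)| * |(D : ℚ)|⁻¹ := by
              gcongr
          _ = 1 := mul_inv_cancel₀ (abs_ne_zero.mpr hD0)
      have h4 : D * z - w = 0 := by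
        rw [← Int.abs_lt_one_iff]
        exact_mod_cast h3
      rw [h4, Int.cast_zero, mul_eq_zero, div_eq_zero_iff] at h2
      exact (h2.resolve_left hD0).resolve_right hb
    refine eq_zero_of_infinite_isRoot _ ((hinf.image (Nat.cast_injective (R := ℚ)).injOn).mono ?_)
    rintro _ ⟨q, hq, rfl⟩
    exact hroot q hq
  refine ⟨A / B, fun q _ => ?_⟩
  rw [hdecomp q, hzero]
  simp [mul_comm]

/-! ### Double counting -/

section DoubleCounting

variable {α β T : Type*} (S : α → β → Prop)

theorem card_pairs_swap :
    Nat.card {x : α × β // S x.1 x.2} = Nat.card {y : β × α // S y.2 y.1} :=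
  Nat.card_congr ((Equiv.prodComm α β).subtypeEquiv fun _ => Iff.rfl)

variable [Finite α] [Finite β]

/-- Pairs are counted by fibres over the first component, the fibres having a cardinality that
depends only on an invariant `τ`. -/
theorem card_pairs_eq_sum (p : α → Prop) (τ : α → T) (Ts : Finset T) (c : T → ℚ)
    (hp : ∀ a b, S a b → p a) (hT : ∀ a, p a → τ a ∈ Ts)
    (hc : ∀ a, p a → (Nat.card {b // S a b} : ℚ) = c (τ a)) :
    (Nat.card {x : α × β // S x.1 x.2} : ℚ) =
      ∑ t ∈ Ts, (Nat.card {a // p a ∧ τ a = t} : ℚ) * c t := by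
  classical
  have := Fintype.ofFinite α
  have := Fintype.ofFinite β
  have h1 : Nat.card {x : α × β // S x.1 x.2} = ∑ a : α, Nat.card {b // S a b} := by
    rw [← Nat.card_sigma]
    exact Nat.card_congr
      { toFun := fun x => ⟨x.1.1, x.1.2, x.2⟩
        invFun := fun x => ⟨(x.1, x.2.1), x.2.2⟩
        left_inv := fun _ => rfl
        right_inv := fun _ => rfl }
  have h2 : ∀ a, (Nat.card {b // S a b} : ℚ) = ∑ t ∈ Ts, if p a ∧ τ a = t then c t else 0 := by
    intro a
    by_cases ha : p a
    · rw [hc a ha, Finset.sum_eq_single (τ a)]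
      · simp [ha]
      · intro t _ ht
        simp [ht.symm]
      · intro h
        exact absurd (hT a ha) h
    · have : IsEmpty {b // S a b} := ⟨fun b => ha (hp a b.1 b.2)⟩
      simp [ha]
  rw [h1, Nat.cast_sum, Finset.sum_congr rfl fun a _ => h2 a, Finset.sum_comm]
  refine Finset.sum_congr rfl fun t _ => ?_
  rw [← Finset.sum_filter, Finset.sum_const, nsmul_eq_mul, Nat.card_eq_fintype_card,
    Fintype.card_subtype]

theorem card_pairs_eq_mul (p : α → Prop) (c : ℚ) (hp : ∀ a b, S a b → p a)
    (hc : ∀ a, p a → (Nat.card {b // S a b} : ℚ) = c) :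
    (Nat.card {x : α × β // S x.1 x.2} : ℚ) = Nat.card {a // p a} * c := by
  rw [card_pairs_eq_sum S p (fun _ => ()) {()} (fun _ => c) hp (by simp) hc]
  simp

theorem card_eq_sum (p : α → Prop) (τ : α → T) (Ts : Finset T) (hT : ∀ a, p a → τ a ∈ Ts) :
    (Nat.card {a // p a} : ℚ) = ∑ t ∈ Ts, (Nat.card {a // p a ∧ τ a = t} : ℚ) := by
  have h1 := card_pairs_eq_mul (fun a (_ : Unit) => p a) p 1 (fun a _ h => h)
    (fun a ha => by simp [ha])
  have h2 := card_pairs_eq_sum (fun a (_ : Unit) => p a) p τ Ts (fun _ => 1) (fun a _ h => h) hT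
    (fun a ha => by simp [ha])
  rw [h1] at h2
  simpa using h2

end DoubleCounting

/-! ### Dimensions of `K[X]`-submodules -/

section Dimension

variable {K M : Type*} [Field K] [AddCommGroup M] [Module K[X] M] {A B N N' : Submodule K[X] M}

/-- The elements that `f` maps into `A`. -/
noncomputable def preSMul (f : K[X]) (A : Submodule K[X] M) : Submodule K[X] M :=
  A.comap (LinearMap.lsmul K[X] M f)

@[simp] theorem mem_preSMul {f : K[X]} {x : M} : x ∈ preSMul f A ↔ f • x ∈ A := Iff.rfl

theorem smul_le_iff {f : K[X]} : f • N ≤ A ↔ N ≤ preSMul f A := by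
  constructor
  · intro h x hx
    exact h (Submodule.smul_mem_pointwise_smul x f N hx)
  · intro h x hx
    obtain ⟨y, hy, rfl⟩ := (Submodule.mem_smul_pointwise_iff_exists _ _ _).mp hx
    exact h hy

variable [Module K M] [IsScalarTower K K[X] M]

/-- The dimension over `K` of a `K[X]`-submodule. -/
noncomputable def kdim (N : Submodule K[X] M) : ℕ :=
  Module.finrank K (N.restrictScalars K)

@[simp] theorem kdim_bot : kdim (⊥ : Submodule K[X] M) = 0 := by
  unfold kdim
  rw [Submodule.restrictScalars_bot, finrank_bot]

@[simp] theorem kdim_top : kdim (⊤ : Submodule K[X] M) = Module.finrank K M := by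
  unfold kdim
  rw [Submodule.restrictScalars_top, finrank_top]

variable [Module.Finite K M]

theorem kdim_sup_add_kdim_inf (A B : Submodule K[X] M) :
    kdim (A ⊔ B) + kdim (A ⊓ B) = kdim A + kdim B := by
  have := Submodule.finrank_sup_add_finrank_inf_eq (A.restrictScalars K) (B.restrictScalars K)
  unfold kdim
  rw [Submodule.restrictScalars_sup, Submodule.restrictScalars_inf]
  exact this

theorem kdim_mono (h : A ≤ B) : kdim A ≤ kdim B :=
  Submodule.finrank_mono (s := A.restrictScalars K) (t := B.restrictScalars K) h

theorem eq_of_le_of_kdim_le (h : A ≤ B) (h' : kdim B ≤ kdim A) : A = B := by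
  have := Submodule.eq_of_le_of_finrank_le
    (S₁ := A.restrictScalars K) (S₂ := B.restrictScalars K) h h'
  exact Submodule.restrictScalars_injective K K[X] M this

theorem kdim_strictMono (h : A < B) : kdim A < kdim B :=
  lt_of_not_ge fun h' => h.ne (eq_of_le_of_kdim_le h.le h')

theorem natCard_eq_pow_kdim (N : Submodule K[X] M) : Nat.card N = Nat.card K ^ kdim N :=
  Module.natCard_eq_pow_finrank (K := K) (V := N.restrictScalars K)

theorem finrank_map_add_finrank_ker {V W : Type*} [AddCommGroup V] [Module K V] [AddCommGroup W]
    [Module K W] [Module.Finite K V] (g : V →ₗ[K] W) (N : Submodule K V) :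
    Module.finrank K (N.map g) + Module.finrank K (N ⊓ LinearMap.ker g : Submodule K V) =
      Module.finrank K N := by
  rw [← LinearMap.finrank_range_add_finrank_ker (g.domRestrict N), LinearMap.range_domRestrict,
    LinearMap.ker_domRestrict, ← Submodule.finrank_map_subtype_eq, Submodule.map_comap_subtype]

/-- Rank-nullity for multiplication by `f`, applied to `S` and to `S ⊓ preSMul f A`: both
restrictions have the same kernel, and the second image is `f • S ⊓ A`. -/
theorem kdim_smul_sup_add (f : K[X]) (S A : Submodule K[X] M) :
    kdim (f • S ⊔ A) + kdim (S ⊓ preSMul f A) = kdim S + kdim A := by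
  let g : M →ₗ[K] M := (LinearMap.lsmul K[X] M f).restrictScalars K
  have hg : ∀ N : Submodule K[X] M, kdim (f • N) +
      Module.finrank K (N.restrictScalars K ⊓ LinearMap.ker g : Submodule K M) = kdim N :=
    fun N => finrank_map_add_finrank_ker g (N.restrictScalars K)
  have h1 := hg S
  have h2 := hg (S ⊓ preSMul f A)
  have h3 : (S ⊓ preSMul f A).restrictScalars K ⊓ LinearMap.ker g =
      S.restrictScalars K ⊓ LinearMap.ker g := by
    ext x
    simp only [Submodule.restrictScalars_inf, Submodule.mem_inf, Submodule.restrictScalars_mem,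
      mem_preSMul, LinearMap.mem_ker]
    constructor
    · tauto
    · rintro ⟨h, h'⟩
      refine ⟨⟨h, ?_⟩, h'⟩
      rw [show f • x = 0 from h']
      exact A.zero_mem
  have h4 : f • (S ⊓ preSMul f A) = f • S ⊓ A := by
    ext x
    simp only [Submodule.mem_inf, Submodule.mem_smul_pointwise_iff_exists, mem_preSMul]
    constructor
    · rintro ⟨y, ⟨h, h'⟩, rfl⟩
      exact ⟨⟨y, h, rfl⟩, h'⟩
    · rintro ⟨⟨y, h, rfl⟩, h'⟩
      exact ⟨y, ⟨h, h'⟩, rfl⟩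
  have h5 := kdim_sup_add_kdim_inf (f • S) A
  rw [h3, h4] at h2
  omega

end Dimension

/-! ### Submodules over one prime: counting by linear algebra -/

section Grafting

variable {K M : Type*} [Field K] [AddCommGroup M] [Module K[X] M]

/-- If `f` and `g` are coprime, then `f v ∈ N` and `g v ∈ N` give `v ∈ N`. -/
theorem mem_of_isCoprime_smul_mem {f g : K[X]} (h : IsCoprime f g) {N : Submodule K[X] M} {v : M}
    (hf : f • v ∈ N) (hg : g • v ∈ N) : v ∈ N := by
  obtain ⟨a, b, hab⟩ := h
  rw [← one_smul K[X] v, ← hab, add_smul, mul_smul, mul_smul]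
  exact N.add_mem (N.smul_mem a hf) (N.smul_mem b hg)

variable [Module K M] [IsScalarTower K K[X] M]

theorem kdim_eq_finrank_of_linearEquiv {M' : Type*} [AddCommGroup M'] [Module K[X] M']
    [Module K M'] [IsScalarTower K K[X] M'] {N : Submodule K[X] M} (e : M' ≃ₗ[K[X]] N) :
    Module.finrank K M' = kdim N :=
  LinearEquiv.finrank_eq (R := K) (M := M') (N := N.restrictScalars K)
    (e.restrictScalars K : M' ≃ₗ[K] N)

variable [Module.Finite K M] {A B : Submodule K[X] M}

theorem kdim_map_mkQ_add (h : A ≤ B) : kdim (B.map A.mkQ) + kdim A = kdim B := by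
  have := finrank_map_add_finrank_ker (A.mkQ.restrictScalars K) (B.restrictScalars K)
  have h2 : B.restrictScalars K ⊓ LinearMap.ker (A.mkQ.restrictScalars K) =
      A.restrictScalars K := by
    ext x
    simpa using fun hx => h hx
  rw [h2] at this
  exact this

/-- Modulo `N`, the vector `v` generates a copy of `K[X] / (f)`: its annihilator is proper and
contains the maximal ideal `(f)`. -/
theorem kdim_sup_span_singleton {f : K[X]} (hf : Irreducible f) {N : Submodule K[X] M} {v : M}
    (hv : v ∉ N) (hfv : f • v ∈ N) :
    kdim (N ⊔ Submodule.span K[X] {v}) = kdim N + f.natDegree := by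
  rw [← kdim_map_mkQ_add (le_sup_left : N ≤ N ⊔ Submodule.span K[X] {v}), add_comm]
  congr 1
  let φ := LinearMap.toSpanSingleton K[X] (M ⧸ N) (N.mkQ v)
  have hφ : (N ⊔ Submodule.span K[X] {v}).map N.mkQ = LinearMap.range φ := by
    rw [Submodule.map_sup, LinearMap.range_toSpanSingleton, Submodule.map_span,
      Set.image_singleton]
    simp
  have hker : LinearMap.ker φ = Ideal.span {f} := by
    have hmax := PrincipalIdealRing.isMaximal_of_irreducible hf
    refine ((hmax.eq_of_le (J := LinearMap.ker φ) ?_ ?_)).symm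
    · intro h
      have : (1 : K[X]) ∈ LinearMap.ker φ := h ▸ Submodule.mem_top
      simp [φ] at this
      exact hv this
    · rw [Ideal.span_singleton_le_iff_mem]
      change φ f = 0
      simpa [φ, ← Submodule.Quotient.mk_smul] using hfv
  rw [hφ, ← kdim_eq_finrank_of_linearEquiv φ.quotKerEquivRange, ← finrank_quotient_span_eq_natDegree]
  exact LinearEquiv.finrank_eq ((Submodule.quotEquivOfEq _ _ hker).restrictScalars K)

/-- Number of submodules `N` of given dimension between `N'` and `U` that meet `T` in `N'`, where
`U / N'` is killed by an irreducible `f`. -/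
theorem card_transversal_submodules (e : ℕ) (he : 0 < e) (c : ℕ) : ∀ t u : ℕ, ∃ ρ : ℕ → ℚ,
    IsRational ρ ∧ ∀ (K : Type u) [Field K] [Finite K] (M : Type u) [AddCommGroup M]
      [Module K[X] M] [Module K M] [IsScalarTower K K[X] M] [Module.Finite K M]
      (f : K[X]), Irreducible f → f.natDegree = e → ∀ N' T U : Submodule K[X] M,
      N' ≤ T → T ≤ U → f • U ≤ N' → kdim T = kdim N' + t → kdim U = kdim N' + u →
      (Nat.card {N : Submodule K[X] M // N' ≤ N ∧ N ≤ U ∧ N ⊓ T = N' ∧ kdim N = kdim N' + c} : ℚ) =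
        ρ (Nat.card K) := by
  induction c using Nat.strong_induction_on with
  | _ c ih =>
  intro t u
  rcases Nat.eq_zero_or_pos c with rfl | hc
  · refine ⟨fun _ => 1, IsRational.const 1, ?_⟩
    intro K _ _ M _ _ _ _ _ f hf hfe N' T U hT hU hfU ht hu
    have : Unique {N : Submodule K[X] M // N' ≤ N ∧ N ≤ U ∧ N ⊓ T = N' ∧ kdim N = kdim N' + 0} :=
      { default := ⟨N', le_rfl, hT.trans hU, inf_eq_left.mpr hT, rfl⟩
        uniq := fun N => Subtype.ext (eq_of_le_of_kdim_le N.2.1 N.2.2.2.2.le).symm }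
    simp
  -- `N / N'` is a vector space over `K[X] / (f)`, so if it is nonzero its dimension is at least
  -- `e`.
  by_cases hce : c < e
  · refine ⟨fun _ => 0, IsRational.const 0, ?_⟩
    intro K _ _ M _ _ _ _ _ f hf hfe N' T U hT hU hfU ht hu
    have : IsEmpty {N : Submodule K[X] M // N' ≤ N ∧ N ≤ U ∧ N ⊓ T = N' ∧ kdim N = kdim N' + c} := by
      refine ⟨fun ⟨N, h1, h2, h3, h4⟩ => ?_⟩
      have hlt : N' < N := lt_of_le_of_ne h1 (by rintro rfl; omega)
      obtain ⟨v, hvN, hv⟩ := SetLike.exists_of_lt hlt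
      have h5 := kdim_sup_span_singleton hf hv
        (hfU (Submodule.smul_mem_pointwise_smul v f U (h2 hvN)))
      have h6 := kdim_mono (K := K) (show N' ⊔ Submodule.span K[X] {v} ≤ N from
        sup_le h1 ((Submodule.span_singleton_le_iff_mem _ _).mpr hvN))
      omega
    simp
  -- Count pairs `(N, v)` with `v ∈ N \ N'`. Each `N` admits `(q ^ c - 1) * q ^ kdim N'` vectors;
  -- each `v ∈ U \ T` leaves the same problem with `(v)` added to `N'` and `T`. This lowers `c` and
  -- `u` by `e` and keeps `t`.
  obtain ⟨ρ, hρ, h⟩ := ih (c - e) (by omega) t (u - e)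
  refine ⟨fun q => ((q : ℚ) ^ u - (q : ℚ) ^ t) * ρ q / ((q : ℚ) ^ c - 1),
    (((IsRational.pow_self u).sub (IsRational.pow_self t)).mul hρ).div
      ((IsRational.pow_self c).sub (IsRational.const 1)) ?_, ?_⟩
  · intro q hq
    have : (1 : ℚ) < (q : ℚ) ^ c := one_lt_pow₀ (by exact_mod_cast hq) hc.ne'
    linarith
  intro K _ _ M _ _ _ _ _ f hf hfe N' T U hT hU hfU ht hu
  have hq : 2 ≤ Nat.card K := Finite.one_lt_card
  have : Finite M := Module.finite_of_finite K
  have hq0 : (0 : ℚ) < Nat.card K := by exact_mod_cast (by omega : 0 < Nat.card K)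
  have hdiff : ∀ A B : Submodule K[X] M, A ≤ B →
      (Nat.card {v : M // v ∈ B ∧ v ∉ A} : ℚ) =
        (Nat.card K : ℚ) ^ kdim B - (Nat.card K : ℚ) ^ kdim A := by
    intro A B hAB
    have h1 : Nat.card {v : M // v ∈ B ∧ v ∉ A} = ((B : Set M) \ (A : Set M)).ncard := rfl
    have h2 := Set.ncard_sdiff_add_ncard_of_subset (s := (A : Set M)) (t := (B : Set M)) hAB
      (Set.toFinite _)
    have h3 : ∀ N : Submodule K[X] M, (N : Set M).ncard = Nat.card K ^ kdim N :=
      fun N => natCard_eq_pow_kdim N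
    rw [h3, h3] at h2
    rw [h1, eq_sub_iff_add_eq]
    exact_mod_cast h2
  let S : Submodule K[X] M → M → Prop := fun N v =>
    (N' ≤ N ∧ N ≤ U ∧ N ⊓ T = N' ∧ kdim N = kdim N' + c) ∧ v ∈ N ∧ v ∉ N'
  have e1 := card_pairs_eq_mul S _ ((Nat.card K : ℚ) ^ (kdim N' + c) - (Nat.card K : ℚ) ^ kdim N')
    (fun N v h => h.1) (fun N hN => by
      simp only [S, hN, true_and]
      rw [hdiff _ _ hN.1, hN.2.2.2])
  have e2 := card_pairs_eq_mul (fun v N => S N v) (fun v => v ∈ U ∧ v ∉ T) (ρ (Nat.card K))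
    (fun v N h => ⟨h.1.2.1 h.2.1, fun hvT => h.2.2 (by rw [← h.1.2.2.1]; exact ⟨h.2.1, hvT⟩)⟩)
    (fun v hv => by
      have hvN' : v ∉ N' := fun h => hv.2 (hT h)
      have hfv : f • v ∈ N' := hfU (Submodule.smul_mem_pointwise_smul v f U hv.1)
      have d1 := kdim_sup_span_singleton hf hvN' hfv
      have d2 := kdim_sup_span_singleton hf hv.2 (hT hfv)
      have hvU : Submodule.span K[X] {v} ≤ U := (Submodule.span_singleton_le_iff_mem _ _).mpr hv.1
      have d3 := kdim_mono (K := K) (sup_le (hT.trans hU) hvU)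
      rw [← h K M f hf hfe (N' ⊔ Submodule.span K[X] {v}) (T ⊔ Submodule.span K[X] {v}) U
        (sup_le_sup_right hT _) (sup_le hU hvU) (hfU.trans le_sup_left) (by omega) (by omega)]
      congr 1
      refine Nat.card_congr (Equiv.subtypeEquivRight fun N => ?_)
      have hdim : ∀ k, k = kdim N' + c ↔ k = kdim N' + f.natDegree + (c - e) := by
        intro k; omega
      simp only [S, d1, sup_le_iff, Submodule.span_singleton_le_iff_mem, hvN', not_false_eq_true,
        and_true, hdim]
      constructor
      · rintro ⟨⟨h1, h2, h3, h4⟩, h5⟩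
        refine ⟨⟨h1, h5⟩, h2, ?_, h4⟩
        rw [← inf_sup_assoc_of_le T ((Submodule.span_singleton_le_iff_mem _ _).mpr h5), h3]
      · rintro ⟨⟨h1, h5⟩, h2, h3, h4⟩
        refine ⟨⟨h1, h2, ?_, h4⟩, h5⟩
        apply le_antisymm
        · intro x hx
          have hx' : x ∈ N' ⊔ Submodule.span K[X] {v} := by
            rw [← h3]
            exact ⟨hx.1, Submodule.mem_sup_left hx.2⟩
          obtain ⟨y, hy, z, hz, rfl⟩ := Submodule.mem_sup.mp hx'
          obtain ⟨a, rfl⟩ := Submodule.mem_span_singleton.mp hz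
          have hav : a • v ∈ T := by
            simpa using T.sub_mem hx.2 (hT hy)
          -- Both `f • v` and `a • v` lie in `T` while `v` does not, so `a` and `f` are not coprime.
          have hdvd : f ∣ a := by
            by_contra hna
            exact hv.2 (mem_of_isCoprime_smul_mem
              ((Irreducible.coprime_iff_not_dvd hf).mpr hna) (hT hfv) hav)
          obtain ⟨b, rfl⟩ := hdvd
          refine N'.add_mem hy ?_
          rw [mul_comm, mul_smul]
          exact N'.smul_mem b hfv
        · exact le_inf h1 hT)
  rw [← card_pairs_swap S, e1, hdiff _ _ hU, ht, hu] at e2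
  have hc1 : (1 : ℚ) < (Nat.card K : ℚ) ^ c := one_lt_pow₀ (by exact_mod_cast hq) hc.ne'
  rw [eq_div_iff (by linarith)]
  have hpos : (Nat.card K : ℚ) ^ kdim N' ≠ 0 := by positivity
  apply mul_left_cancel₀ hpos
  linear_combination e2

/-- Number of submodules that meet the members of a chain `S 0 ≥ S 1 ≥ ⋯` ending with `A` in
given dimensions, where `S 0 / A` is killed by an irreducible `f`. -/
theorem card_submodules_of_chain (e : ℕ) (he : 0 < e) (L : ℕ) : ∀ s c : ℕ → ℕ, ∃ ρ : ℕ → ℚ,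
    IsRational ρ ∧ ∀ (K : Type u) [Field K] [Finite K] (M : Type u) [AddCommGroup M]
      [Module K[X] M] [Module K M] [IsScalarTower K K[X] M] [Module.Finite K M]
      (f : K[X]), Irreducible f → f.natDegree = e → ∀ (A : Submodule K[X] M)
      (S : ℕ → Submodule K[X] M), Antitone S → (∀ i, A ≤ S i) → (∀ i, L ≤ i → S i = A) →
      f • S 0 ≤ A → (∀ i, kdim (S i) = kdim A + s i) →
      (Nat.card {N : Submodule K[X] M // A ≤ N ∧ N ≤ S 0 ∧ ∀ i, kdim (N ⊓ S i) = kdim A + c i} : ℚ)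
        = ρ (Nat.card K) := by
  classical
  induction L with
  | zero =>
    intro s c
    refine ⟨fun _ => if ∀ i, c i = 0 then 1 else 0, IsRational.const _, ?_⟩
    intro K _ _ M _ _ _ _ _ f hf hfe A S hS hAS hL hfS hs
    have hSA : ∀ i, S i = A := fun i => hL i (Nat.zero_le i)
    simp only [hSA]
    split_ifs with hc
    · have : Unique {N : Submodule K[X] M // A ≤ N ∧ N ≤ A ∧ ∀ i, kdim (N ⊓ A) = kdim A + c i} :=
        { default := ⟨A, le_rfl, le_rfl, fun i => by simp [hc]⟩
          uniq := fun N => Subtype.ext (le_antisymm N.2.2.1 N.2.1) }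
      simp
    · have : IsEmpty {N : Submodule K[X] M // A ≤ N ∧ N ≤ A ∧ ∀ i, kdim (N ⊓ A) = kdim A + c i} := by
        refine ⟨fun ⟨N, h1, h2, h3⟩ => hc fun i => ?_⟩
        have := h3 i
        rw [inf_eq_right.mpr h1] at this
        omega
      simp
  | succ L ih =>
    intro s c
    -- Otherwise there are no such `N`, and the truncated difference `c 0 - c 1` would be
    -- misleading.
    by_cases hc : c 1 ≤ c 0
    swap
    · refine ⟨fun _ => 0, IsRational.const 0, ?_⟩
      intro K _ _ M _ _ _ _ _ f hf hfe A S hS hAS hL hfS hs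
      have : IsEmpty {N : Submodule K[X] M //
          A ≤ N ∧ N ≤ S 0 ∧ ∀ i, kdim (N ⊓ S i) = kdim A + c i} := by
        refine ⟨fun ⟨N, h1, h2, h3⟩ => hc ?_⟩
        have h4 := kdim_mono (K := K) (inf_le_inf_left N (hS (Nat.zero_le 1)))
        rw [h3, h3] at h4
        omega
      simp
    -- `N` is chosen in two stages: first `N' = N ⊓ S 1`, governed by the shifted chain, then an `N`
    -- above it inside `S 0` that meets `S 1` only in `N'`. All dimensions in the second stage are
    -- taken modulo `N'`, hence the subtractions of `c 1`.
    obtain ⟨ρ₁, hρ₁, h₁⟩ := ih (fun i => s (i + 1)) (fun i => c (i + 1))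
    obtain ⟨ρ₂, hρ₂, h₂⟩ := card_transversal_submodules e he (c 0 - c 1) (s 1 - c 1) (s 0 - c 1)
    refine ⟨_, hρ₁.mul hρ₂, ?_⟩
    intro K _ _ M _ _ _ _ _ f hf hfe A S hS hAS hL hfS hs
    have : Finite M := Module.finite_of_finite K
    have hS10 : S 1 ≤ S 0 := hS (Nat.zero_le 1)
    rw [← h₁ K M f hf hfe A (fun i => S (i + 1)) (fun i j hij => hS (by omega))
      (fun i => hAS _) (fun i hi => hL _ (by omega)) ((smul_mono_right f hS10).trans hfS)
      fun i => hs _]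
    let R : Submodule K[X] M → Submodule K[X] M → Prop := fun N' N =>
      (A ≤ N ∧ N ≤ S 0 ∧ ∀ i, kdim (N ⊓ S i) = kdim A + c i) ∧ N ⊓ S 1 = N'
    rw [← card_pairs_eq_mul R]
    · rw [card_pairs_swap, ← mul_one (Nat.card _ : ℚ)]
      symm
      apply card_pairs_eq_mul (fun N N' => R N' N)
      · exact fun N N' h => h.1
      · intro N hN
        simp [R, hN]
    · rintro _ N ⟨h, rfl⟩
      refine ⟨le_inf h.1 (hAS 1), inf_le_right, fun i => ?_⟩
      rw [inf_assoc, inf_eq_right.mpr (hS (by omega)), h.2.2]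
    · rintro N' ⟨h1, h2, h3⟩
      rw [zero_add] at h2
      have h30 : kdim N' = kdim A + c 1 := by simpa [inf_eq_left.mpr h2] using h3 0
      have hle := kdim_mono (K := K) h2
      have hle' := kdim_mono (K := K) hS10
      rw [hs, hs] at hle'
      rw [hs, h30] at hle
      rw [← h₂ K M f hf hfe N' (S 1) (S 0) h2 hS10 (hfS.trans h1) (by rw [hs, h30]; omega)
        (by rw [hs, h30]; omega)]
      congr 1
      refine Nat.card_congr (Equiv.subtypeEquivRight fun N => ?_)
      have hdim : ∀ k, k = kdim N' + (c 0 - c 1) ↔ k = kdim A + c 0 := by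
        intro k; omega
      rw [hdim]
      constructor
      · rintro ⟨⟨h4, h5, h6⟩, rfl⟩
        refine ⟨inf_le_left, h5, rfl, ?_⟩
        rw [← h6, inf_eq_left.mpr h5]
      · rintro ⟨h4, h5, rfl, h7⟩
        refine ⟨⟨h1.trans h4, h5, fun i => ?_⟩, rfl⟩
        cases i with
        | zero => rw [inf_eq_left.mpr h5, h7]
        | succ i =>
          rw [← h3, inf_assoc, inf_eq_right.mpr (hS (by omega))]

end Grafting

/-! ### Types of subquotients -/

/-- A family of pairwise coprime irreducible polynomials `F j` of degree `e j`. -/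
structure IsPrimeFamily {K Q : Type*} [Field K] (F : Q → K[X]) (e : Q → ℕ) : Prop where
  irreducible : ∀ j, Irreducible (F j)
  natDegree_eq : ∀ j, (F j).natDegree = e j
  isCoprime : ∀ i j, i ≠ j → IsCoprime (F i) (F j)

/-- The module `M` is killed by a power of the product of the `F j`. -/
def IsSupported {K Q : Type*} [Field K] [Fintype Q] (F : Q → K[X]) (M : Type*) [AddCommGroup M]
    [Module K[X] M] : Prop :=
  ∃ n : ℕ, ∀ x : M, (∏ j, F j) ^ n • x = 0

section RelType

variable {K M Q : Type*} [Field K] [AddCommGroup M] [Module K[X] M]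

theorem smul_level_sup (f : K[X]) (A B : Submodule K[X] M) (i : ℕ) :
    f • (f ^ i • B ⊔ A) ⊔ A = f ^ (i + 1) • B ⊔ A := by
  rw [Submodule.smul_sup', smul_smul, ← pow_succ', sup_assoc,
    sup_eq_right.mpr (Submodule.smul_le_self_of_tower f A)]

theorem level_antitone (f : K[X]) (A B : Submodule K[X] M) :
    Antitone fun i => f ^ i • B ⊔ A := by
  refine antitone_nat_of_succ_le fun i => sup_le_sup_right ?_ A
  rw [pow_succ', mul_smul]
  exact Submodule.smul_le_self_of_tower _ _

theorem level_le (f : K[X]) {A B : Submodule K[X] M} (h : A ≤ B) (i : ℕ) :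
    f ^ i • B ⊔ A ≤ B :=
  sup_le (Submodule.smul_le_self_of_tower _ _) h

/-- On `N₁` modulo `A`, which is killed by `F j`, the coprime `F j'` acts invertibly, so `N₁`
survives in every level of `F j'`. -/
theorem elementary_le_level {F : Q → K[X]} {e : Q → ℕ} (hF : IsPrimeFamily F e)
    {A B N₁ : Submodule K[X] M} {j : Q} (hB : N₁ ≤ B) (hN : F j • N₁ ≤ A) {j' : Q}
    (hj : j' ≠ j) (i : ℕ) : N₁ ≤ F j' ^ i • B ⊔ A := by
  intro x hx
  refine mem_of_isCoprime_smul_mem ((hF.isCoprime j' j hj).pow_left (m := i)) ?_ ?_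
  · exact Submodule.mem_sup_left (Submodule.smul_mem_pointwise_smul _ _ _ (hB hx))
  · exact Submodule.mem_sup_right (hN (Submodule.smul_mem_pointwise_smul _ _ _ hx))

variable [Module K M] [IsScalarTower K K[X] M]

/-- For `A ≤ B`, the dimensions of the modules `F j ^ i • (B / A)`. -/
noncomputable def relType (F : Q → K[X]) (A B : Submodule K[X] M) : Q → ℕ → ℕ :=
  fun j i => kdim (F j ^ i • B ⊔ A) - kdim A

variable [Module.Finite K M] (F : Q → K[X]) {A B : Submodule K[X] M}

theorem kdim_level (A B : Submodule K[X] M) (j : Q) (i : ℕ) :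
    kdim (F j ^ i • B ⊔ A) = kdim A + relType F A B j i := by
  have := kdim_mono (K := K) (le_sup_right : A ≤ F j ^ i • B ⊔ A)
  unfold relType
  omega

theorem relType_zero (h : A ≤ B) (j : Q) : kdim B = kdim A + relType F A B j 0 := by
  rw [← kdim_level, pow_zero, one_smul, sup_eq_left.mpr h]

theorem relType_antitone (A B : Submodule K[X] M) (j : Q) : Antitone (relType F A B j) := by
  intro i i' hi
  have := kdim_mono (K := K) (level_antitone (F j) A B hi)
  simp only [kdim_level] at this
  omega

theorem relType_self (A : Submodule K[X] M) : relType F A A = 0 := by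
  funext j i
  have h := kdim_level F A A j i
  rw [sup_eq_right.mpr (Submodule.smul_le_self_of_tower _ _)] at h
  simpa using h

theorem kdim_level_inf_preSMul (A B : Submodule K[X] M) (j : Q) (i : ℕ) :
    kdim ((F j ^ i • B ⊔ A) ⊓ preSMul (F j) A) =
      kdim A + (relType F A B j i - relType F A B j (i + 1)) := by
  have h1 := kdim_smul_sup_add (F j) (F j ^ i • B ⊔ A) A
  rw [smul_level_sup, kdim_level, kdim_level] at h1
  have h2 := relType_antitone F A B j (Nat.le_succ i)
  simp only [Nat.succ_eq_add_one] at h2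
  omega

/-- Each level `F j ^ i • B ⊔ A` determines the next one, so once two neighbours agree they agree
forever. -/
theorem relType_succ_eq {j : Q} {i : ℕ} (h : relType F A B j i = relType F A B j (i + 1)) :
    relType F A B j (i + 1) = relType F A B j (i + 2) := by
  have h1 : F j ^ (i + 1) • B ⊔ A = F j ^ i • B ⊔ A :=
    eq_of_le_of_kdim_le (level_antitone (F j) A B (Nat.le_succ i)) (by rw [kdim_level, kdim_level, h])
  unfold relType
  rw [← smul_level_sup _ _ _ (i + 1), h1, smul_level_sup, h1]

/-- Starting at `n` or below, the sequence cannot drop `n + 1` times; it repeats at some `k ≤ n` and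
is constant from there on. -/
theorem eq_of_antitone_of_stable {a : ℕ → ℕ} (ha : Antitone a)
    (h : ∀ i, a i = a (i + 1) → a (i + 1) = a (i + 2)) {n i : ℕ} (hn : a 0 ≤ n) (hi : n ≤ i) :
    a i = a n := by
  obtain ⟨k, hk, hk'⟩ : ∃ k ≤ n, a k = a (k + 1) := by
    by_contra! hne
    have : ∀ k ≤ n + 1, a k + k ≤ a 0 := by
      intro k
      induction k with
      | zero => simp
      | succ k ih =>
        intro hk
        have h1 := ih (by omega)
        have h2 := hne k (by omega)
        have h3 := ha (Nat.le_succ k)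
        simp only [Nat.succ_eq_add_one] at h3
        omega
    have := this (n + 1) le_rfl
    omega
  have hst : ∀ m, a (k + m) = a k ∧ a (k + m) = a (k + m + 1) := by
    intro m
    induction m with
    | zero => exact ⟨rfl, hk'⟩
    | succ m ih => exact ⟨by rw [← ih.1, ih.2]; rfl, h _ ih.2⟩
  have h1 := (hst (i - k)).1
  have h2 := (hst (n - k)).1
  rw [Nat.add_sub_cancel' (by omega)] at h1 h2
  rw [h1, h2]

theorem relType_eq_of_le {j : Q} {n i : ℕ} (hn : relType F A B j 0 ≤ n) (hi : n ≤ i) :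
    relType F A B j i = relType F A B j n :=
  eq_of_antitone_of_stable (relType_antitone F A B j) (fun _ => relType_succ_eq F) hn hi

/-- A finite set of functions containing the types of all subquotients of dimension at most
`n`. -/
noncomputable def typeBox (Q : Type*) [Fintype Q] (n : ℕ) : Finset (Q → ℕ → ℕ) := by
  classical
  -- Cutting the index off at `n` loses nothing, because types are constant from the index `n` on.
  exact (Finset.univ : Finset (Q → Fin (n + 1) → Fin (n + 1))).image
    fun g j i => g j ⟨min i n, by omega⟩

theorem relType_mem_typeBox_of_le [Fintype Q] {n : ℕ} (h0 : ∀ j, relType F A B j 0 ≤ n) :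
    relType F A B ∈ typeBox Q n := by
  classical
  unfold typeBox
  refine Finset.mem_image.mpr ⟨fun j i => ⟨relType F A B j i, ?_⟩, Finset.mem_univ _, ?_⟩
  · have := relType_antitone F A B j (Nat.zero_le i)
    have := h0 j
    omega
  · funext j i
    dsimp only
    rcases le_total i n with hi | hi
    · rw [min_eq_left hi]
    · rw [min_eq_right hi, relType_eq_of_le F (h0 j) hi]

theorem relType_mem_typeBox [Fintype Q] (h : A ≤ B) {n : ℕ} (hn : kdim B ≤ kdim A + n) :
    relType F A B ∈ typeBox Q n := by
  refine relType_mem_typeBox_of_le F fun j => ?_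
  have := relType_zero F h j
  omega

variable {F} {e : Q → ℕ} (hF : IsPrimeFamily F e) {N₁ : Submodule K[X] M} {j : Q}

/-- The dimension formula for `N₁` and a level of `B / A`. It turns the type of `B / N₁` at `j` into
the dimensions in which `N₁` meets the levels. -/
theorem relType_elementary_self (hA : A ≤ N₁) (i : ℕ) :
    relType F N₁ B j i + kdim (N₁ ⊓ (F j ^ i • B ⊔ A)) = relType F A B j i + kdim A := by
  have h1 : F j ^ i • B ⊔ N₁ = N₁ ⊔ (F j ^ i • B ⊔ A) := by
    rw [sup_comm N₁, sup_assoc, sup_eq_right.mpr hA]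
  have h2 := kdim_sup_add_kdim_inf N₁ (F j ^ i • B ⊔ A)
  rw [← h1, kdim_level, kdim_level] at h2
  omega

-- Since `N₁` lies in every level of `F j'`, these levels are the same over `N₁` as over `A`; only
-- the base dimension changes.
include hF in
theorem relType_elementary_of_ne (hA : A ≤ N₁) (hB : N₁ ≤ B) (hN : F j • N₁ ≤ A) {j' : Q}
    (hj : j' ≠ j) (i : ℕ) :
    relType F N₁ B j' i = relType F A B j' i - (kdim N₁ - kdim A) := by
  have h1 : F j' ^ i • B ⊔ N₁ = F j' ^ i • B ⊔ A :=
    le_antisymm (sup_le le_sup_left (elementary_le_level hF hB hN hj i)) (sup_le_sup_left hA _)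
  have h2 := kdim_level F N₁ B j' i
  rw [h1, kdim_level] at h2
  have := kdim_mono (K := K) hA
  omega

/-- Every `F j` acts surjectively on `B / A`, hence so does every power of their product. One such
power is zero on `M`. -/
theorem le_of_forall_relType_eq [Fintype Q] (hM : IsSupported F M) (h : A ≤ B)
    (ht : ∀ j, relType F A B j 1 = relType F A B j 0) : B ≤ A := by
  classical
  have h1 : ∀ j, F j • B ⊔ A = B := by
    intro j
    have := kdim_level F A B j 1
    rw [pow_one] at this
    refine eq_of_le_of_kdim_le (by simpa using level_le (F j) h 1) ?_
    rw [this, ht, ← relType_zero F h]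
  have h2 : ∀ s : Finset Q, (∏ j ∈ s, F j) • B ⊔ A = B := by
    intro s
    induction s using Finset.induction_on with
    | empty => simpa using h
    | insert j s hj ih =>
      rw [Finset.prod_insert hj, mul_smul, ← sup_eq_right.mpr
        (Submodule.smul_le_self_of_tower (F j) A), ← sup_assoc, ← Submodule.smul_sup', ih, h1]
  obtain ⟨n, hn⟩ := hM
  have h3 : ∀ k, (∏ j, F j) ^ k • B ⊔ A = B := by
    intro k
    induction k with
    | zero => simpa using h
    | succ k ih => rw [← smul_level_sup, ih, h2]
  rw [← h3 n]
  refine sup_le ?_ le_rfl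
  intro x hx
  obtain ⟨y, -, rfl⟩ := (Submodule.mem_smul_pointwise_iff_exists _ _ _).mp hx
  rw [hn]
  exact A.zero_mem

/-- The type of the quotient of `B / A` by its `F j`-socle. -/
theorem relType_socle_self (h : A ≤ B) (i : ℕ) :
    relType F (B ⊓ preSMul (F j) A) B j i = relType F A B j (i + 1) := by
  have hA : A ≤ preSMul (F j) A := smul_le_iff.mp (Submodule.smul_le_self_of_tower _ _)
  have h1 := relType_elementary_self (F := F) (B := B) (j := j) (le_inf h hA) i
  have h2 : B ⊓ preSMul (F j) A ⊓ (F j ^ i • B ⊔ A) = (F j ^ i • B ⊔ A) ⊓ preSMul (F j) A := by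
    rw [inf_right_comm, inf_eq_right.mpr (level_le _ h _)]
  rw [h2, kdim_level_inf_preSMul] at h1
  have h3 := relType_antitone F A B j (Nat.le_succ i)
  simp only [Nat.succ_eq_add_one] at h3
  omega

theorem kdim_socle (h : A ≤ B) :
    kdim (B ⊓ preSMul (F j) A) = kdim A + (relType F A B j 0 - relType F A B j 1) := by
  have := kdim_level_inf_preSMul F A B j 0
  rwa [pow_zero, one_smul, sup_eq_left.mpr h] at this

include hF in
theorem socle_le_relType_of_ne (h : A ≤ B) {j' : Q} (hj : j' ≠ j) (i : ℕ) :
    relType F A B j 0 - relType F A B j 1 ≤ relType F A B j' i := by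
  have := kdim_mono (K := K) (elementary_le_level hF (B := B) inf_le_left
    (smul_le_iff.mpr (inf_le_right (a := B) (b := preSMul (F j) A))) hj i)
  rw [kdim_socle h, kdim_level] at this
  omega

end RelType

/-- Number of elementary submodules with prescribed type of the quotient. -/
theorem card_elementary_submodules {Q : Type} [Fintype Q] (e : Q → ℕ) (he : ∀ j, 0 < e j) (j : Q)
    (c : ℕ) (m m' : Q → ℕ → ℕ) : ∃ ρ : ℕ → ℚ, IsRational ρ ∧
    ∀ (K : Type u) [Field K] [Finite K] (F : Q → K[X]), IsPrimeFamily F e →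
      ∀ (M : Type u) [AddCommGroup M] [Module K[X] M] [Module K M] [IsScalarTower K K[X] M]
      [Module.Finite K M] (A B : Submodule K[X] M), A ≤ B → relType F A B = m →
      (Nat.card {N : Submodule K[X] M // A ≤ N ∧ N ≤ B ∧ F j • N ≤ A ∧ kdim N = kdim A + c ∧
        relType F N B = m'} : ℚ) = ρ (Nat.card K) := by
  classical
  by_cases hcond : (∀ j', j' ≠ j → ∀ i, m' j' i = m j' i - c) ∧ (∀ i, m' j i ≤ m j i) ∧
    m j 0 = m' j 0 + c
  · obtain ⟨hne, hle, h0⟩ := hcond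
    -- The conditions at other primes hold automatically by `hne`. At `j`, cotype `m'` says that `N`
    -- meets the `i`-th level in dimension `m j i - m' j i` over `A`. As `N` lies in the `F
    -- j`-socle, only the socles of the levels matter, and these form the chain.
    obtain ⟨ρ, hρ, h⟩ := card_submodules_of_chain (e j) (he j) (m j 0)
      (fun i => m j i - m j (i + 1)) (fun i => m j i - m' j i)
    refine ⟨ρ, hρ, ?_⟩
    rintro K _ _ F hF M _ _ _ _ _ A B hAB rfl
    have hA : A ≤ preSMul (F j) A := smul_le_iff.mp (Submodule.smul_le_self_of_tower _ _)
    rw [← h K M (F j) (hF.irreducible j) (hF.natDegree_eq j) A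
      (fun i => (F j ^ i • B ⊔ A) ⊓ preSMul (F j) A)
      (fun i i' hi => inf_le_inf_right _ (level_antitone (F j) A B hi))
      (fun i => le_inf le_sup_right hA) ?_ ?_ (fun i => kdim_level_inf_preSMul F A B j i)]
    · congr 1
      refine Nat.card_congr (Equiv.subtypeEquivRight fun N => ?_)
      simp only [pow_zero, one_smul, sup_eq_left.mpr hAB, le_inf_iff, ← smul_le_iff]
      have hinf : F j • N ≤ A → ∀ i, N ⊓ ((F j ^ i • B ⊔ A) ⊓ preSMul (F j) A) =
          N ⊓ (F j ^ i • B ⊔ A) := by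
        intro hN i
        rw [← inf_assoc, inf_eq_left.mpr (inf_le_left.trans (smul_le_iff.mp hN))]
      constructor
      · rintro ⟨h1, h2, h3, h4, rfl⟩
        refine ⟨h1, ⟨h2, h3⟩, fun i => ?_⟩
        rw [hinf h3]
        have := relType_elementary_self (F := F) (B := B) (j := j) h1 i
        have := hle i
        omega
      · rintro ⟨h1, ⟨h2, h3⟩, h4⟩
        simp only [hinf h3] at h4
        have h5 : kdim N = kdim A + c := by
          have := h4 0
          simp only [pow_zero, one_smul, sup_eq_left.mpr hAB, inf_eq_left.mpr h2] at this
          omega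
        refine ⟨h1, h2, h3, h5, ?_⟩
        funext j' i
        by_cases hj : j' = j
        · subst hj
          have := relType_elementary_self (F := F) (B := B) (j := j') h1 i
          have := hle i
          have := h4 i
          omega
        · rw [relType_elementary_of_ne hF h1 h2 h3 hj, hne j' hj, h5]
          omega
    -- The levels are stationary from the index `m j 0` on, so there `F j` is injective modulo `A`
    -- and the socle is zero.
    · intro i hi
      refine (eq_of_le_of_kdim_le (le_inf le_sup_right hA) ?_).symm
      rw [kdim_level_inf_preSMul, relType_eq_of_le F le_rfl hi,
        relType_eq_of_le F le_rfl (by omega : relType F A B j 0 ≤ i + 1)]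
      simp
    · exact smul_le_iff.mpr inf_le_right
  · refine ⟨fun _ => 0, IsRational.const 0, ?_⟩
    rintro K _ _ F hF M _ _ _ _ _ A B hAB rfl
    have : IsEmpty {N : Submodule K[X] M // A ≤ N ∧ N ≤ B ∧ F j • N ≤ A ∧ kdim N = kdim A + c ∧
        relType F N B = m'} := by
      refine ⟨fun ⟨N, h1, h2, h3, h4, h5⟩ => hcond ⟨fun j' hj i => ?_, fun i => ?_, ?_⟩⟩
      · rw [← h5, relType_elementary_of_ne hF h1 h2 h3 hj, h4]
        omega
      · have := relType_elementary_self (F := F) (B := B) (j := j) h1 i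
        have h6 := kdim_mono (K := K) (le_inf h1 (le_sup_right : A ≤ F j ^ i • B ⊔ A))
        rw [← h5]
        omega
      · have := relType_elementary_self (F := F) (B := B) (j := j) h1 0
        simp only [pow_zero, one_smul, sup_eq_left.mpr hAB, inf_eq_left.mpr h2] at this
        rw [← h5]
        omega
    simp

/-! ### Hall numbers -/

/-- The Hall numbers: the number of submodules of given type and cotype is a rational function
of `q` determined by the types. -/
def HallRational {Q : Type} [Fintype Q] (e : Q → ℕ) (m t b : Q → ℕ → ℕ) : Prop :=
  ∃ ρ : ℕ → ℚ, IsRational ρ ∧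
    ∀ (K : Type u) [Field K] [Finite K] (F : Q → K[X]), IsPrimeFamily F e →
      ∀ (M : Type u) [AddCommGroup M] [Module K[X] M] [Module K M] [IsScalarTower K K[X] M]
      [Module.Finite K M] (A B : Submodule K[X] M), IsSupported F M → A ≤ B →
      relType F A B = m →
      (Nat.card {N : Submodule K[X] M // A ≤ N ∧ N ≤ B ∧ relType F A N = t ∧
        relType F N B = b} : ℚ) = ρ (Nat.card K)

section Hall

variable {Q : Type} {e : Q → ℕ}

open scoped Classical in
/-- The type of the quotient of a module of type `t` by its socle at `j`. -/
noncomputable def socleQuotientType (t : Q → ℕ → ℕ) (j : Q) : Q → ℕ → ℕ :=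
  fun j' i => if j' = j then t j (i + 1) else t j' i - (t j 0 - t j 1)

section

variable {K M : Type*} [Field K] [AddCommGroup M] [Module K[X] M] [Module K M]
  [IsScalarTower K K[X] M] [Module.Finite K M] {F : Q → K[X]} {A N N₁ : Submodule K[X] M}
  {t : Q → ℕ → ℕ} {j : Q}

theorem relType_socle (hF : IsPrimeFamily F e) (h : A ≤ N) :
    relType F (N ⊓ preSMul (F j) A) N = socleQuotientType (relType F A N) j := by
  funext j' i
  unfold socleQuotientType
  have hA : A ≤ preSMul (F j) A := smul_le_iff.mp (Submodule.smul_le_self_of_tower _ _)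
  split_ifs with hj
  · rw [hj]
    exact relType_socle_self h i
  · rw [relType_elementary_of_ne hF (le_inf h hA) inf_le_left (smul_le_iff.mpr inf_le_right) hj,
      kdim_socle h]
    congr 1
    omega

/-- A module that has an elementary submodule and quotient like those of a module of type `t` has
a larger socle at `j`, or type `t`. -/
theorem socle_le_of_elementary (hF : IsPrimeFamily F e) {a : ℕ} (hta : ∀ j, t j 0 = a)
    (htj : t j 1 < a) (htne : ∀ j' ≠ j, ∀ i, t j 0 - t j 1 ≤ t j' i) (h1 : A ≤ N₁) (h2 : N₁ ≤ N) (h3 : F j • N₁ ≤ A)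
    (h4 : kdim N₁ = kdim A + (t j 0 - t j 1)) (h5 : relType F N₁ N = socleQuotientType t j) :
    (∀ j', relType F A N j' 0 = a) ∧ relType F A N j 1 ≤ t j 1 ∧
      (relType F A N j 1 = t j 1 → relType F A N = t ∧ N₁ = N ⊓ preSMul (F j) A) := by
  have hle : N₁ ≤ N ⊓ preSMul (F j) A := le_inf h2 (smul_le_iff.mp h3)
  have hdim := kdim_mono (K := K) hle
  have hAN := h1.trans h2
  rw [kdim_socle hAN, h4] at hdim
  have e1 := relType_zero F h2 j
  rw [h5] at e1
  simp only [socleQuotientType, ↓reduceIte, zero_add] at e1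
  have hj := hta j
  have h0 : ∀ j', relType F A N j' 0 = a := by
    intro j'
    have := relType_zero F hAN j'
    omega
  have h0j := h0 j
  have hanti := relType_antitone F A N j (Nat.zero_le 1)
  refine ⟨h0, by omega, fun heq => ?_⟩
  -- By dimension `N₁` is the whole socle. The type of `N` can then be recovered from that of `N /
  -- N₁`: at `j` the shift forgets only the index 0, where the value is `a`; at other primes the
  -- bounds `h7` and `h8` make the truncated subtraction reversible.
  have hN₁ : N₁ = N ⊓ preSMul (F j) A := eq_of_le_of_kdim_le hle (by rw [kdim_socle hAN]; omega)
  refine ⟨?_, hN₁⟩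
  rw [hN₁, relType_socle hF hAN] at h5
  funext j' i
  by_cases hjj : j' = j
  · subst hjj
    cases i with
    | zero => rw [h0j, hj]
    | succ i =>
      have := congrFun (congrFun h5 j') i
      simpa [socleQuotientType] using this
  · have h6 := congrFun (congrFun h5 j') i
    simp only [socleQuotientType, hjj, ↓reduceIte] at h6
    have h7 := socle_le_relType_of_ne hF hAN hjj i
    have h8 := htne j' hjj i
    omega

end

variable [Fintype Q]

/-- A supported module without socle at any prime is zero, so only `N = A` can occur. -/
theorem hallRational_of_socle_eq_zero (m t b : Q → ℕ → ℕ) (ht : ∀ j, t j 1 = t j 0) :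
    HallRational.{u} e m t b := by
  classical
  refine ⟨fun _ => if t = 0 ∧ m = b then 1 else 0, IsRational.const _, ?_⟩
  rintro K _ _ F hF M _ _ _ _ _ A B hM hAB rfl
  have hN : ∀ N : Submodule K[X] M, A ≤ N → relType F A N = t → N = A := by
    rintro N h1 rfl
    exact le_antisymm (le_of_forall_relType_eq hM h1 ht) h1
  split_ifs with h
  · obtain ⟨rfl, rfl⟩ := h
    have : Unique {N : Submodule K[X] M // A ≤ N ∧ N ≤ B ∧ relType F A N = 0 ∧
        relType F N B = relType F A B} :=
      { default := ⟨A, le_rfl, hAB, relType_self F A, rfl⟩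
        uniq := fun N => Subtype.ext (hN N.1 N.2.1 N.2.2.2.1) }
    simp
  · have : IsEmpty {N : Submodule K[X] M // A ≤ N ∧ N ≤ B ∧ relType F A N = t ∧
        relType F N B = b} := by
      refine ⟨fun ⟨N, h1, h2, h3, h4⟩ => h ?_⟩
      obtain rfl := hN N h1 h3
      exact ⟨by rw [← h3, relType_self], h4⟩
    simp

theorem hallRational_of_not_realized (m t b : Q → ℕ → ℕ)
    (h : ∀ (K : Type u) [Field K] [Finite K] (F : Q → K[X]), IsPrimeFamily F e →
      ∀ (M : Type u) [AddCommGroup M] [Module K[X] M] [Module K M] [IsScalarTower K K[X] M]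
      [Module.Finite K M] (A N : Submodule K[X] M), A ≤ N → relType F A N ≠ t) :
    HallRational.{u} e m t b := by
  refine ⟨fun _ => 0, IsRational.const 0, ?_⟩
  rintro K _ _ F hF M _ _ _ _ _ A B hM hAB rfl
  have : IsEmpty {N : Submodule K[X] M // A ≤ N ∧ N ≤ B ∧ relType F A N = t ∧
      relType F N B = b} := ⟨fun N => h K F hF M A N.1 N.2.1 N.2.2.2.1⟩
  simp

/-- The outer induction is on the dimension `a` of `N / A`. With a prime `j` fixed at which the
socle is nonzero, the inner one is on `t j 1`, which is small when the `F j`-socle is large. -/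
theorem hallRational_aux (he : ∀ j, 0 < e j) (a : ℕ) : ∀ t : Q → ℕ → ℕ, (∀ j, t j 0 = a) →
    ∀ m b, HallRational.{u} e m t b := by
  classical
  induction a using Nat.strong_induction_on with
  | _ a iha =>
  intro t hta m b
  by_cases hsoc : ∀ j, t j 1 = t j 0
  · exact hallRational_of_socle_eq_zero m t b hsoc
  push Not at hsoc
  obtain ⟨j, hj⟩ := hsoc
  suffices H : ∀ k < a, ∀ t : Q → ℕ → ℕ, (∀ j, t j 0 = a) → t j 1 = k →
      HallRational.{u} e m t b by
    by_cases hja : t j 1 ≤ t j 0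
    · have := hta j
      exact H _ (by omega) t hta rfl
    · apply hallRational_of_not_realized
      rintro K _ _ F hF M _ _ _ _ _ A N hAN rfl
      exact hja (relType_antitone F A N j (Nat.zero_le 1))
  clear hj hta t
  intro k
  induction k using Nat.strong_induction_on with
  | _ k ihk =>
  intro hka t hta htk
  have hta' := hta j
  by_cases htne : ∀ j' ≠ j, ∀ i, t j 0 - t j 1 ≤ t j' i
  swap
  · apply hallRational_of_not_realized
    rintro K _ _ F hF M _ _ _ _ _ A N hAN rfl
    exact htne fun j' hj i => socle_le_relType_of_ne hF hAN hj i
  -- Modulo its socle a module of type `t` has dimension `t j 1 = k < a`, so the outer induction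
  -- applies.
  have hquot : ∀ m', HallRational.{u} e m' (socleQuotientType t j) b := by
    intro m'
    refine iha k hka _ (fun j' => ?_) m' b
    unfold socleQuotientType
    have := hta j'
    split_ifs <;> omega
  choose ρ₁ hρ₁ h₁ using hquot
  choose ρ₂ hρ₂ h₂ using fun m m' => card_elementary_submodules.{u} e he j (t j 0 - t j 1) m m'
  have hlow : ∀ t'' : Q → ℕ → ℕ, ∃ ρ : ℕ → ℚ, IsRational ρ ∧
      ((∀ j, t'' j 0 = a) → t'' j 1 < k → ∀ (K : Type u) [Field K] [Finite K] (F : Q → K[X]), IsPrimeFamily F e →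
      ∀ (M : Type u) [AddCommGroup M] [Module K[X] M] [Module K M] [IsScalarTower K K[X] M]
      [Module.Finite K M] (A B : Submodule K[X] M), IsSupported F M → A ≤ B →
      relType F A B = m →
      (Nat.card {N : Submodule K[X] M // A ≤ N ∧ N ≤ B ∧ relType F A N = t'' ∧
        relType F N B = b} : ℚ) = ρ (Nat.card K)) := by
    intro t''
    by_cases h : (∀ j, t'' j 0 = a) ∧ t'' j 1 < k
    · obtain ⟨ρ, hρ, h'⟩ := ihk _ h.2 (h.2.trans hka) t'' h.1 rfl
      exact ⟨ρ, hρ, fun _ _ => h'⟩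
    · exact ⟨fun _ => 0, IsRational.const 0, fun h1 h2 => absurd ⟨h1, h2⟩ h⟩
  choose ρ₃ hρ₃ h₃ using hlow
  -- All pairs, counted from `N₁`, minus the pairs in which `N` has a strictly larger `F j`-socle;
  -- what remains is one pair for each `N` of type `t`.
  refine ⟨_, (IsRational.sum (typeBox Q (m j 0)) fun m' _ => (hρ₂ m m').mul (hρ₁ m')).sub
    (IsRational.sum ((typeBox Q (m j 0)).filter fun t'' => (∀ j, t'' j 0 = a) ∧ t'' j 1 < k)
      fun t'' _ => (hρ₃ t'').mul (hρ₂ t'' (socleQuotientType t j))), ?_⟩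
  rintro K _ _ F hF M _ _ _ _ _ A B hM hAB hm
  have : Finite M := Module.finite_of_finite K
  have hB := relType_zero F hAB j
  rw [hm] at hB
  let S : Submodule K[X] M → Submodule K[X] M → Prop := fun N₁ N =>
    A ≤ N₁ ∧ N₁ ≤ N ∧ N ≤ B ∧ F j • N₁ ≤ A ∧ kdim N₁ = kdim A + (t j 0 - t j 1) ∧
      relType F N₁ N = socleQuotientType t j ∧ relType F N B = b
  have e1 := card_pairs_eq_sum S
    (fun N₁ => A ≤ N₁ ∧ N₁ ≤ B ∧ F j • N₁ ≤ A ∧ kdim N₁ = kdim A + (t j 0 - t j 1))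
    (fun N₁ => relType F N₁ B) (typeBox Q (m j 0)) (fun m' => ρ₁ m' (Nat.card K))
    (fun N₁ N h => ⟨h.1, h.2.1.trans h.2.2.1, h.2.2.2.1, h.2.2.2.2.1⟩)
    (fun N₁ h => relType_mem_typeBox F h.2.1 (by have := kdim_mono (K := K) h.1; omega))
    (fun N₁ h => by
      rw [← h₁ _ K F hF M N₁ B hM h.2.1 rfl]
      congr 1
      refine Nat.card_congr (Equiv.subtypeEquivRight fun N => ?_)
      simp only [S]
      tauto)
  have e2 := card_pairs_eq_sum (fun N N₁ => S N₁ N)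
    (fun N => A ≤ N ∧ N ≤ B ∧ relType F N B = b)
    (fun N => relType F A N) (typeBox Q (m j 0))
    (fun t'' => ρ₂ t'' (socleQuotientType t j) (Nat.card K))
    (fun N N₁ h => ⟨h.1.trans h.2.1, h.2.2.1, h.2.2.2.2.2.2⟩)
    (fun N h => relType_mem_typeBox F h.1 (by have := kdim_mono (K := K) h.2.1; omega))
    (fun N h => by
      rw [← h₂ _ _ K F hF M A N h.1 rfl]
      congr 1
      refine Nat.card_congr (Equiv.subtypeEquivRight fun N => ?_)
      simp only [S]
      tauto)
  rw [← card_pairs_swap] at e2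
  have e3 := e1.symm.trans e2
  have e4 : ∀ m', (Nat.card {N₁ : Submodule K[X] M // (A ≤ N₁ ∧ N₁ ≤ B ∧ F j • N₁ ≤ A ∧
      kdim N₁ = kdim A + (t j 0 - t j 1)) ∧ relType F N₁ B = m'} : ℚ) = ρ₂ m m' (Nat.card K) := by
    intro m'
    rw [← h₂ m m' K F hF M A B hAB hm]
    congr 1
    refine Nat.card_congr (Equiv.subtypeEquivRight fun N => ?_)
    tauto
  simp only [e4] at e3
  rw [e3, eq_sub_iff_add_eq]
  let H : (Q → ℕ → ℕ) → ℚ := fun t'' => Nat.card {N : Submodule K[X] M // A ≤ N ∧ N ≤ B ∧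
    relType F A N = t'' ∧ relType F N B = b}
  have e5 : ∀ t'', (Nat.card {N : Submodule K[X] M // (A ≤ N ∧ N ≤ B ∧ relType F N B = b) ∧
      relType F A N = t''} : ℚ) = H t'' := by
    intro t''
    simp only [H]
    congr 1
    refine Nat.card_congr (Equiv.subtypeEquivRight fun N => ?_)
    tauto
  simp only [e5]
  have hH0 : ∀ t'', (∀ N : Submodule K[X] M, A ≤ N → N ≤ B → relType F A N = t'' → False) →
      H t'' = 0 := by
    intro t'' h
    have : IsEmpty {N : Submodule K[X] M // A ≤ N ∧ N ≤ B ∧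
      relType F A N = t'' ∧ relType F N B = b} := ⟨fun N => h N.1 N.2.1 N.2.2.1 N.2.2.2.1⟩
    simp [H]
  have hterm : ∀ t'', H t'' * ρ₂ t'' (socleQuotientType t j) (Nat.card K) =
      (if t'' = t then H t else 0) + if (∀ j, t'' j 0 = a) ∧ t'' j 1 < k then
        ρ₃ t'' (Nat.card K) * ρ₂ t'' (socleQuotientType t j) (Nat.card K) else 0 := by
    intro t''
    by_cases hex : ∃ N : Submodule K[X] M, A ≤ N ∧ N ≤ B ∧ relType F A N = t''
    swap
    · have hz := hH0 t'' fun N h1 h2 h3 => hex ⟨N, h1, h2, h3⟩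
      rw [hz, zero_mul]
      have : (if t'' = t then H t else 0) = 0 := by
        split_ifs with h
        · rw [← h, hz]
        · rfl
      rw [this]
      split_ifs with h
      · rw [← h₃ t'' h.1 h.2 K F hF M A B hM hAB hm, show (Nat.card _ : ℚ) = H t'' from rfl, hz]
        simp
      · simp
    obtain ⟨N, hAN, hNB, hN⟩ := hex
    by_cases htt : t'' = t
    · have : ¬ ((∀ j, t'' j 0 = a) ∧ t'' j 1 < k) := by
        rw [htt]; omega
      rw [if_neg this, if_pos htt, add_zero]
      -- Inside an `N` of type `t` the only admissible `N₁` is its `F j`-socle.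
      have hone : ρ₂ t'' (socleQuotientType t j) (Nat.card K) = 1 := by
        rw [← h₂ t'' _ K F hF M A N hAN hN]
        rw [htt] at hN
        have hsocle : A ≤ N ⊓ preSMul (F j) A :=
          le_inf hAN (smul_le_iff.mp (Submodule.smul_le_self_of_tower _ _))
        have : Unique {N₁ : Submodule K[X] M // A ≤ N₁ ∧ N₁ ≤ N ∧ F j • N₁ ≤ A ∧
            kdim N₁ = kdim A + (t j 0 - t j 1) ∧ relType F N₁ N = socleQuotientType t j} :=
          { default := ⟨N ⊓ preSMul (F j) A, hsocle, inf_le_left, smul_le_iff.mpr inf_le_right,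
              by rw [kdim_socle hAN, hN], by rw [relType_socle hF hAN, hN]⟩
            uniq := fun ⟨N₁, h1, h2, h3, h4, h5⟩ => Subtype.ext
              ((socle_le_of_elementary hF hta (by omega) htne h1 h2 h3 h4 h5).2.2
                (by rw [hN])).2 }
        simp
      rw [hone, mul_one, htt]
    · rw [if_neg htt, zero_add]
      split_ifs with h
      · rw [← h₃ t'' h.1 h.2 K F hF M A B hM hAB hm]
      · have hzero : ρ₂ t'' (socleQuotientType t j) (Nat.card K) = 0 := by
          rw [← h₂ t'' _ K F hF M A N hAN hN]
          have : IsEmpty {N₁ : Submodule K[X] M // A ≤ N₁ ∧ N₁ ≤ N ∧ F j • N₁ ≤ A ∧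
              kdim N₁ = kdim A + (t j 0 - t j 1) ∧ relType F N₁ N = socleQuotientType t j} := by
            refine ⟨fun ⟨N₁, h1, h2, h3, h4, h5⟩ => ?_⟩
            obtain ⟨g1, g2, g3⟩ := socle_le_of_elementary hF hta (by omega) htne h1 h2 h3 h4 h5
            rw [hN] at g1 g2 g3
            have : t'' j 1 ≠ t j 1 := fun h => htt (g3 h).1
            exact h ⟨g1, by omega⟩
          simp
        rw [hzero, mul_zero]
  rw [Finset.sum_congr rfl fun t'' _ => hterm t'', Finset.sum_add_distrib, Finset.sum_filter]
  congr 1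
  rw [Finset.sum_ite_eq']
  split_ifs with h
  · rfl
  · exact hH0 t fun N h1 h2 h3 => h (h3 ▸ relType_mem_typeBox F h1
      (by have := kdim_mono (K := K) h2; omega))

/-- For a realized type every `t j 0` is the full dimension of the module, so these values must
agree. -/
theorem hallRational (he : ∀ j, 0 < e j) (m t b : Q → ℕ → ℕ) : HallRational.{u} e m t b := by
  rcases isEmpty_or_nonempty Q with hQ | ⟨⟨j⟩⟩
  · exact hallRational_of_socle_eq_zero m t b fun j => hQ.elim j
  by_cases h : ∀ j', t j' 0 = t j 0
  · exact hallRational_aux he (t j 0) t h m b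
  · apply hallRational_of_not_realized
    rintro K _ _ F hF M _ _ _ _ _ A N hAN rfl
    refine h fun j' => ?_
    have := relType_zero F hAN j
    have := relType_zero F hAN j'
    omega

/-- The number of chains of submodules from `A` to `B` with successive quotients of given types
is a rational function of `q`. -/
theorem card_chains_rational (he : ∀ j, 0 < e j) (l : ℕ) : ∀ (m : Q → ℕ → ℕ)
    (b : Fin l → Q → ℕ → ℕ), ∃ ρ : ℕ → ℚ, IsRational ρ ∧
    ∀ (K : Type u) [Field K] [Finite K] (F : Q → K[X]), IsPrimeFamily F e →
      ∀ (M : Type u) [AddCommGroup M] [Module K[X] M] [Module K M] [IsScalarTower K K[X] M]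
      [Module.Finite K M] (A B : Submodule K[X] M), IsSupported F M → A ≤ B →
      relType F A B = m →
      (Nat.card {W : Fin (l + 1) → Submodule K[X] M // W 0 = A ∧ W (Fin.last l) = B ∧
        (∀ i : Fin l, W i.castSucc ≤ W i.succ) ∧
        ∀ i : Fin l, relType F (W i.castSucc) (W i.succ) = b i} : ℚ) = ρ (Nat.card K) := by
  classical
  induction l with
  | zero =>
    intro m b
    refine ⟨fun _ => if m = 0 then 1 else 0, IsRational.const _, ?_⟩
    rintro K _ _ F hF M _ _ _ _ _ A B hM hAB rfl
    split_ifs with h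
    · have hBA : B = A := le_antisymm (le_of_forall_relType_eq hM hAB (by simp [h])) hAB
      subst hBA
      have : Unique {W : Fin (0 + 1) → Submodule K[X] M // W 0 = B ∧ W (Fin.last 0) = B ∧
          (∀ i : Fin 0, W i.castSucc ≤ W i.succ) ∧
          ∀ i : Fin 0, relType F (W i.castSucc) (W i.succ) = b i} :=
        { default := ⟨fun _ => B, rfl, rfl, fun i => i.elim0, fun i => i.elim0⟩
          uniq := fun W => Subtype.ext (funext fun i => by
            rw [Fin.fin_one_eq_zero i]; exact W.2.1) }
      rw [Nat.card_unique, Nat.cast_one]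
    · have : IsEmpty {W : Fin (0 + 1) → Submodule K[X] M // W 0 = A ∧ W (Fin.last 0) = B ∧
          (∀ i : Fin 0, W i.castSucc ≤ W i.succ) ∧
          ∀ i : Fin 0, relType F (W i.castSucc) (W i.succ) = b i} := by
        refine ⟨fun ⟨W, h1, h2, _⟩ => h ?_⟩
        obtain rfl : A = B := h1.symm.trans h2
        exact relType_self F A
      rw [Nat.card_of_isEmpty, Nat.cast_zero]
  | succ l ih =>
    intro m b
    -- Split a chain at `W 1` and sort by the type of `B / W 1`: a Hall number counts the choices of
    -- `W 1`, the induction hypothesis the rest of the chain. The sum of all `m j 0` is a bound that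
    -- also makes sense for empty `Q`.
    choose ρ₁ hρ₁ h₁ using fun m' => hallRational.{u} he m (b 0) m'
    choose ρ₂ hρ₂ h₂ using fun m' => ih m' (fun i => b i.succ)
    refine ⟨_, IsRational.sum (typeBox Q (∑ j, m j 0)) fun m' _ => (hρ₁ m').mul (hρ₂ m'), ?_⟩
    rintro K _ _ F hF M _ _ _ _ _ A B hM hAB hm
    have : Finite M := Module.finite_of_finite K
    let S : Submodule K[X] M → (Fin (l + 1) → Submodule K[X] M) → Prop := fun N W =>
      (A ≤ N ∧ relType F A N = b 0) ∧ W 0 = N ∧ W (Fin.last l) = B ∧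
        (∀ i : Fin l, W i.castSucc ≤ W i.succ) ∧
        ∀ i : Fin l, relType F (W i.castSucc) (W i.succ) = b i.succ
    have e1 := card_pairs_eq_sum S (fun N => A ≤ N ∧ N ≤ B ∧ relType F A N = b 0)
      (fun N => relType F N B) (typeBox Q (∑ j, m j 0)) (fun m' => ρ₂ m' (Nat.card K))
      (fun N W h => by
        refine ⟨h.1.1, ?_, h.1.2⟩
        rw [← h.2.1, ← h.2.2.1]
        exact Fin.monotone_iff_le_succ.mpr h.2.2.2.1 (Fin.zero_le _))
      (fun N h => relType_mem_typeBox_of_le F fun j => by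
        have h1 := relType_zero F hAB j
        have h2 := relType_zero F h.2.1 j
        have h3 := kdim_mono (K := K) h.1
        have h4 := Finset.single_le_sum (f := fun j => m j 0) (fun _ _ => Nat.zero_le _)
          (Finset.mem_univ j)
        rw [hm] at h1
        omega)
      (fun N h => by
        rw [← h₂ _ K F hF M N B hM h.2.1 rfl]
        congr 1
        refine Nat.card_congr (Equiv.subtypeEquivRight fun W => ?_)
        simp only [S]
        tauto)
    have e2 : ∀ m', (Nat.card {N : Submodule K[X] M // (A ≤ N ∧ N ≤ B ∧ relType F A N = b 0) ∧
        relType F N B = m'} : ℚ) = ρ₁ m' (Nat.card K) := by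
      intro m'
      rw [← h₁ m' K F hF M A B hM hAB hm]
      congr 1
      refine Nat.card_congr (Equiv.subtypeEquivRight fun W => ?_)
      tauto
    simp only [e2] at e1
    rw [← e1]
    congr 1
    refine Nat.card_congr
      { toFun := fun W => ⟨(W.1 1, Fin.tail W.1), ?_⟩
        invFun := fun x => ⟨Fin.cons A x.1.2, ?_⟩
        left_inv := ?_
        right_inv := ?_ }
    · obtain ⟨W, h0, hl, hle, ht⟩ := W
      subst h0
      exact ⟨⟨hle 0, ht 0⟩, rfl, hl, fun i => hle i.succ, fun i => ht i.succ⟩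
    · obtain ⟨⟨N, W⟩, h1, h2, h3, h4, h5⟩ := x
      dsimp only at h1 h2 h3 h4 h5 ⊢
      refine ⟨rfl, h3, fun i => ?_, fun i => ?_⟩
      · refine Fin.cases ?_ (fun i => h4 i) i
        change A ≤ W 0
        rw [h2]
        exact h1.1
      · refine Fin.cases ?_ (fun i => h5 i) i
        change relType F A (W 0) = b 0
        rw [h2]
        exact h1.2
    · rintro ⟨W, h0, h⟩
      refine Subtype.ext ?_
      simp only
      rw [← h0]
      exact Fin.cons_self_tail W
    · rintro ⟨⟨N, W⟩, h1, h2, h3⟩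
      refine Subtype.ext (Prod.ext ?_ ?_)
      · exact h2
      · rfl

end Hall

/-! ### Counting homomorphisms -/

section TypesOfModules

variable {K M M' Q : Type*} [Field K] [AddCommGroup M] [Module K[X] M] [AddCommGroup M']
  [Module K[X] M']

theorem map_pointwise_smul (g : M →ₗ[K[X]] M') (f : K[X]) (N : Submodule K[X] M) :
    (f • N).map g = f • N.map g := by
  ext y
  simp only [Submodule.mem_map, Submodule.mem_smul_pointwise_iff_exists]
  constructor
  · rintro ⟨_, ⟨x, hx, rfl⟩, rfl⟩
    exact ⟨g x, ⟨x, hx, rfl⟩, (map_smul g f x).symm⟩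
  · rintro ⟨_, ⟨x, hx, rfl⟩, rfl⟩
    exact ⟨f • x, ⟨x, hx, rfl⟩, map_smul g f x⟩

variable [Module K M] [IsScalarTower K K[X] M] [Module K M'] [IsScalarTower K K[X] M']
  (F : Q → K[X])

theorem kdim_map_of_injective (g : M →ₗ[K[X]] M') (hg : Function.Injective g)
    (N : Submodule K[X] M) : kdim (N.map g) = kdim N :=
  ((Submodule.equivMapOfInjective (g.restrictScalars K) hg (N.restrictScalars K)).finrank_eq).symm

theorem relType_map_of_injective (g : M →ₗ[K[X]] M') (hg : Function.Injective g)
    (A B : Submodule K[X] M) : relType F (A.map g) (B.map g) = relType F A B := by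
  funext j i
  unfold relType
  rw [← map_pointwise_smul, ← Submodule.map_sup, kdim_map_of_injective g hg,
    kdim_map_of_injective g hg]

theorem relType_bot_top_of_linearEquiv (g : M ≃ₗ[K[X]] M') :
    relType F (⊥ : Submodule K[X] M) ⊤ = relType F (⊥ : Submodule K[X] M') ⊤ := by
  have := relType_map_of_injective F g.toLinearMap g.injective ⊥ ⊤
  rw [← this, Submodule.map_bot, Submodule.map_top, LinearEquiv.range]

theorem relType_bot_top (j : Q) (i : ℕ) :
    relType F (⊥ : Submodule K[X] M) ⊤ j i = kdim (F j ^ i • (⊤ : Submodule K[X] M)) := by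
  simp [relType]

variable [Module.Finite K M]

theorem relType_quotient (L : Submodule K[X] M) :
    relType F (⊥ : Submodule K[X] (M ⧸ L)) ⊤ = relType F L ⊤ := by
  funext j i
  have h := kdim_map_mkQ_add (le_sup_right : L ≤ F j ^ i • ⊤ ⊔ L)
  rw [Submodule.map_sup, map_pointwise_smul, Submodule.map_top, Submodule.range_mkQ,
    Submodule.mkQ_map_self, sup_bot_eq] at h
  rw [relType_bot_top]
  unfold relType
  omega

theorem relType_subquotient {A B : Submodule K[X] M} (h : A ≤ B) :
    relType F (⊥ : Submodule K[X] (B ⧸ A.submoduleOf B)) ⊤ = relType F A B := by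
  have : Module.Finite K B := inferInstanceAs (Module.Finite K (B.restrictScalars K))
  rw [relType_quotient, ← relType_map_of_injective F B.subtype B.injective_subtype,
    Submodule.map_top, Submodule.range_subtype, Submodule.submoduleOf,
    Submodule.map_comap_subtype, inf_eq_right.mpr h]

end TypesOfModules

section TypesOfCyclicModules

variable {K Q : Type*} [Field K] {F : Q → K[X]} {e : Q → ℕ}

theorem relType_pi {ι : Type*} [Fintype ι] {Y : ι → Type*} [∀ s, AddCommGroup (Y s)]
    [∀ s, Module K[X] (Y s)] [∀ s, Module K (Y s)] [∀ s, IsScalarTower K K[X] (Y s)]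
    [∀ s, Module.Finite K (Y s)] (j : Q) (i : ℕ) :
    relType F (⊥ : Submodule K[X] (∀ s, Y s)) ⊤ j i =
      ∑ s, relType F (⊥ : Submodule K[X] (Y s)) ⊤ j i := by
  simp only [relType_bot_top]
  let g : ((F j ^ i • (⊤ : Submodule K[X] (∀ s, Y s))).restrictScalars K) ≃ₗ[K]
      ∀ s, ((F j ^ i • (⊤ : Submodule K[X] (Y s))).restrictScalars K) :=
    { toFun := fun y s => ⟨y.1 s, by
        obtain ⟨x, -, hx⟩ := (Submodule.mem_smul_pointwise_iff_exists _ _ _).mp y.2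
        exact (Submodule.mem_smul_pointwise_iff_exists _ _ _).mpr
          ⟨x s, Submodule.mem_top, congrFun hx s⟩⟩
      map_add' := fun _ _ => rfl
      map_smul' := fun _ _ => rfl
      invFun := fun y => ⟨fun s => (y s).1, by
        choose x hx using fun s =>
          (Submodule.mem_smul_pointwise_iff_exists _ _ _).mp (y s).2
        exact (Submodule.mem_smul_pointwise_iff_exists _ _ _).mpr
          ⟨x, Submodule.mem_top, funext fun s => (hx s).2⟩⟩
      left_inv := fun _ => rfl
      right_inv := fun _ => rfl }
  have h := g.finrank_eq
  rw [Module.finrank_pi_fintype] at h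
  exact h

theorem finite_quotient_span_singleton {f : K[X]} (hf : f ≠ 0) :
    Module.Finite K (K[X] ⧸ Ideal.span {f}) :=
  PowerBasis.finite (AdjoinRoot.powerBasis hf)

theorem smul_quotient_span_singleton_eq_zero {f g : K[X]} (h : g ∣ f)
    (x : K[X] ⧸ Ideal.span {g}) : f • x = 0 := by
  obtain ⟨y, rfl⟩ := Ideal.Quotient.mk_surjective x
  change Ideal.Quotient.mk _ (f * y) = 0
  rw [Ideal.Quotient.eq_zero_iff_mem, Ideal.mem_span_singleton]
  exact h.mul_right y

theorem span_singleton_eq_smul_top (f : K[X]) : Ideal.span {f} = f • (⊤ : Submodule K[X] K[X]) := by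
  ext x
  rw [Ideal.mem_span_singleton, Submodule.mem_smul_pointwise_iff_exists]
  simp [dvd_def, eq_comm]

/-- For `i ≤ k`, dividing by the multiples of `F j ^ i` leaves `K[X] / (F j ^ i)`; for `i ≥ k` there
are no nonzero multiples. A different prime acts invertibly. -/
theorem relType_cyclic [DecidableEq Q] (hF : IsPrimeFamily F e) (j j' : Q) (i k : ℕ) :
    relType F (⊥ : Submodule K[X] (K[X] ⧸ Ideal.span {F j ^ k})) ⊤ j' i =
      if j' = j then e j * (k - i) else e j * k := by
  have hne : ∀ a, F j ^ a ≠ 0 := fun a => pow_ne_zero a (hF.irreducible j).ne_zero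
  have := finite_quotient_span_singleton (hne k)
  rw [relType_bot_top]
  have htop : ∀ k, Module.finrank K (K[X] ⧸ Ideal.span {F j ^ k}) = e j * k := by
    intro k
    rw [finrank_quotient_span_eq_natDegree, natDegree_pow, hF.natDegree_eq, mul_comm]
  split_ifs with hj
  · subst hj
    rcases le_total k i with hki | hik
    · have : F j' ^ i • (⊤ : Submodule K[X] (K[X] ⧸ Ideal.span {F j' ^ k})) = ⊥ := by
        rw [eq_bot_iff]
        intro x hx
        obtain ⟨y, -, rfl⟩ := (Submodule.mem_smul_pointwise_iff_exists _ _ _).mp hx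
        exact smul_quotient_span_singleton_eq_zero (pow_dvd_pow _ hki) y
      rw [this, kdim_bot, Nat.sub_eq_zero_of_le hki, mul_zero]
    · have h1 := kdim_map_mkQ_add
        (le_top : F j' ^ i • (⊤ : Submodule K[X] (K[X] ⧸ Ideal.span {F j' ^ k})) ≤ ⊤)
      rw [Submodule.map_top, Submodule.range_mkQ, kdim_top, kdim_top, htop] at h1
      have h2 : F j' ^ i • (⊤ : Submodule K[X] (K[X] ⧸ Ideal.span {F j' ^ k})) =
          Submodule.map (Submodule.mkQ (Ideal.span {F j' ^ k})) (Ideal.span {F j' ^ i}) := by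
        rw [span_singleton_eq_smul_top (F j' ^ i), map_pointwise_smul, Submodule.map_top,
          Submodule.range_mkQ]
      have h3 : Module.finrank K ((K[X] ⧸ Ideal.span {F j' ^ k}) ⧸
          (F j' ^ i • (⊤ : Submodule K[X] (K[X] ⧸ Ideal.span {F j' ^ k})))) = e j' * i := by
        rw [← htop i]
        refine LinearEquiv.finrank_eq (LinearEquiv.restrictScalars K
          ((Submodule.quotEquivOfEq _ _ h2).trans
            (Submodule.quotientQuotientEquivQuotient _ _ ?_)))
        exact Ideal.span_singleton_le_span_singleton.mpr (pow_dvd_pow _ hik)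
      rw [h3] at h1
      rw [Nat.mul_sub]
      omega
  · have : F j' ^ i • (⊤ : Submodule K[X] (K[X] ⧸ Ideal.span {F j ^ k})) = ⊤ := by
      rw [eq_top_iff]
      intro x _
      refine mem_of_isCoprime_smul_mem ((hF.isCoprime j' j hj).pow (m := i) (n := k))
        (Submodule.smul_mem_pointwise_smul _ _ _ Submodule.mem_top) ?_
      rw [smul_quotient_span_singleton_eq_zero dvd_rfl]
      exact Submodule.zero_mem _
    rw [this, kdim_top, htop]

end TypesOfCyclicModules

/-! ### The number of homomorphisms is a power of `q` -/

section HomLaw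

variable {K Q : Type*} [Field K] [Fintype Q] (F : Q → K[X]) (e : Q → ℕ)

/-- The dimension of the space of homomorphisms from a module of type `x` to one of type `m`. -/
noncomputable def homExponent (n : ℕ) (x m : Q → ℕ → ℕ) : ℚ :=
  -- The differences at `j` are `e j` times the numbers of parts exceeding `i`, whence the single
  -- division by `e j`.
  ∑ j, ∑ i ∈ Finset.range n, ((m j i : ℚ) - m j (i + 1)) * ((x j i : ℚ) - x j (i + 1)) / e j

/-- The homomorphisms from `X` to `M` are counted by the types. -/
def HomLaw (n : ℕ) (X M : Type*) [AddCommGroup X] [Module K[X] X] [Module K X]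
    [AddCommGroup M] [Module K[X] M] [Module K M] [IsScalarTower K K[X] X] [IsScalarTower K K[X] M] : Prop :=
  ∃ h : ℕ, Nat.card (X →ₗ[K[X]] M) = Nat.card K ^ h ∧
    (h : ℚ) = homExponent e n (relType F (⊥ : Submodule K[X] X) ⊤)
      (relType F (⊥ : Submodule K[X] M) ⊤)

variable {F e}

section

variable {X X' M : Type*} [AddCommGroup X] [Module K[X] X] [Module K X] [AddCommGroup X']
  [Module K[X] X'] [Module K X'] [AddCommGroup M] [Module K[X] M] [Module K M]
  [IsScalarTower K K[X] X] [IsScalarTower K K[X] X'] [IsScalarTower K K[X] M] {n : ℕ}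

theorem HomLaw.of_linearEquiv (g : X ≃ₗ[K[X]] X') (h : HomLaw F e n X' M) : HomLaw F e n X M := by
  obtain ⟨k, h1, h2⟩ := h
  refine ⟨k, ?_, ?_⟩
  · rw [← h1]
    exact Nat.card_congr (LinearEquiv.congrLeft M K[X] g).toEquiv
  · rw [h2, relType_bot_top_of_linearEquiv F g]

theorem HomLaw.of_subsingleton [Subsingleton X] : HomLaw F e n X M := by
  refine ⟨0, ?_, ?_⟩
  · have : Subsingleton (X →ₗ[K[X]] M) := ⟨fun f g => by
      ext x
      rw [Subsingleton.elim x 0, map_zero, map_zero]⟩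
    rw [pow_zero]
    exact Nat.card_of_subsingleton 0
  · have : ∀ j i, relType F (⊥ : Submodule K[X] X) ⊤ j i = 0 := by
      intro j i
      rw [relType_bot_top, Subsingleton.elim (F j ^ i • (⊤ : Submodule K[X] X)) ⊥, kdim_bot]
    simp [homExponent, this]

theorem HomLaw.pi {ι : Type*} [Fintype ι] {Y : ι → Type*} [∀ s, AddCommGroup (Y s)]
    [∀ s, Module K[X] (Y s)] [∀ s, Module K (Y s)] [∀ s, IsScalarTower K K[X] (Y s)]
    [∀ s, Module.Finite K (Y s)] (h : ∀ s, HomLaw F e n (Y s) M) :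
    HomLaw F e n (∀ s, Y s) M := by
  classical
  choose k h1 h2 using h
  refine ⟨∑ s, k s, ?_, ?_⟩
  · rw [← Finset.prod_pow_eq_pow_sum, ← Finset.prod_congr rfl fun s _ => h1 s, ← Nat.card_pi]
    exact Nat.card_congr (LinearMap.lsum K[X] Y K[X]).symm.toEquiv
  · rw [Nat.cast_sum, Finset.sum_congr rfl fun s _ => h2 s]
    unfold homExponent
    rw [Finset.sum_comm]
    refine Finset.sum_congr rfl fun j _ => ?_
    rw [Finset.sum_comm]
    refine Finset.sum_congr rfl fun i _ => ?_
    simp only [relType_pi]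
    push_cast
    rw [← Finset.sum_sub_distrib, Finset.mul_sum, Finset.sum_div]

end

theorem natCard_hom_cyclic {M : Type*} [AddCommGroup M] [Module K[X] M] (f : K[X]) :
    Nat.card ((K[X] ⧸ Ideal.span {f}) →ₗ[K[X]] M) =
      Nat.card (preSMul f (⊥ : Submodule K[X] M)) := by
  refine Nat.card_congr
    { toFun := fun φ => ⟨φ (Ideal.Quotient.mk _ 1), ?_⟩
      invFun := fun x => Submodule.liftQ _ (LinearMap.toSpanSingleton K[X] M x.1) ?_
      left_inv := ?_
      right_inv := ?_ }
  · rw [mem_preSMul, ← map_smul, smul_quotient_span_singleton_eq_zero dvd_rfl, map_zero]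
    exact Submodule.zero_mem _
  · rw [Ideal.span, Submodule.span_singleton_le_iff_mem]
    simpa using mem_preSMul.mp x.2
  · intro φ
    refine Submodule.linearMap_qext _ (LinearMap.ext_ring ?_)
    change (1 : K[X]) • φ _ = φ _
    rw [one_smul]
    rfl
  · intro x
    refine Subtype.ext ?_
    change (1 : K[X]) • x.1 = x.1
    rw [one_smul]

variable (hF : IsPrimeFamily F e)
include hF

/-- Homomorphisms are the elements of `M` killed by `F j ^ k`, a space of dimension `m j 0 - m j k`.
The differences of the cyclic type are `e j` below `k` and 0 from there on, so the exponent
telescopes to this number. -/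
theorem HomLaw.cyclic {M : Type*} [AddCommGroup M] [Module K[X] M] [Module K M]
    [IsScalarTower K K[X] M] [Module.Finite K M] (j : Q) {k n : ℕ} (hk : k ≤ n) :
    HomLaw F e n (K[X] ⧸ Ideal.span {F j ^ k}) M := by
  classical
  refine ⟨kdim (preSMul (F j ^ k) (⊥ : Submodule K[X] M)), ?_, ?_⟩
  · rw [← natCard_eq_pow_kdim, natCard_hom_cyclic]
  · have h1 := kdim_smul_sup_add (F j ^ k) (⊤ : Submodule K[X] M) ⊥
    have h0 := relType_bot_top (M := M) F j 0
    rw [pow_zero, one_smul] at h0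
    rw [sup_bot_eq, top_inf_eq, kdim_bot, ← relType_bot_top, ← h0] at h1
    have he : (e j : ℚ) ≠ 0 := by
      rw [← hF.natDegree_eq]
      exact_mod_cast (hF.irreducible j).natDegree_pos.ne'
    unfold homExponent
    rw [Finset.sum_eq_single j]
    · rw [← Finset.sum_subset (Finset.range_mono hk)]
      · have h2 : ∀ i ∈ Finset.range k,
            ((relType F (⊥ : Submodule K[X] M) ⊤ j i : ℚ) -
              relType F (⊥ : Submodule K[X] M) ⊤ j (i + 1)) *
            ((relType F (⊥ : Submodule K[X] (K[X] ⧸ Ideal.span {F j ^ k})) ⊤ j i : ℚ) -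
              relType F (⊥ : Submodule K[X] (K[X] ⧸ Ideal.span {F j ^ k})) ⊤ j (i + 1)) / e j =
            (relType F (⊥ : Submodule K[X] M) ⊤ j i : ℚ) -
              relType F (⊥ : Submodule K[X] M) ⊤ j (i + 1) := by
          intro i hi
          have hik := Finset.mem_range.mp hi
          rw [relType_cyclic hF, relType_cyclic hF, if_pos rfl, if_pos rfl, Nat.cast_mul,
            Nat.cast_mul, Nat.cast_sub hik.le, Nat.cast_sub hik]
          push_cast
          field_simp
          ring
        rw [Finset.sum_congr rfl h2, Finset.sum_range_sub']
        rw [eq_sub_iff_add_eq]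
        exact_mod_cast (by omega)
      · intro i _ hi
        have hik : k ≤ i := by simpa using hi
        rw [relType_cyclic hF, relType_cyclic hF, if_pos rfl, if_pos rfl,
          Nat.sub_eq_zero_of_le hik, Nat.sub_eq_zero_of_le (by omega)]
        simp
    · intro j' _ hj
      simp [relType_cyclic hF, hj]
    · simp

end HomLaw

section CountingInjections

variable {K Q : Type*} [Field K] [Fintype Q] {F : Q → K[X]} {e : Q → ℕ}

theorem IsSupported.of_surjective {M M' : Type*} [AddCommGroup M] [Module K[X] M]
    [AddCommGroup M'] [Module K[X] M'] (g : M →ₗ[K[X]] M') (hg : Function.Surjective g)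
    (h : IsSupported F M) : IsSupported F M' := by
  obtain ⟨n, hn⟩ := h
  refine ⟨n, fun y => ?_⟩
  obtain ⟨x, rfl⟩ := hg y
  rw [← map_smul, hn, map_zero]

theorem IsSupported.of_injective {M M' : Type*} [AddCommGroup M] [Module K[X] M]
    [AddCommGroup M'] [Module K[X] M'] (g : M →ₗ[K[X]] M') (hg : Function.Injective g)
    (h : IsSupported F M') : IsSupported F M := by
  obtain ⟨n, hn⟩ := h
  refine ⟨n, fun y => hg ?_⟩
  rw [map_smul, hn, map_zero]

/-- Both the exponent and the type are additive in `X`, so the primary decomposition reduces to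
cyclic modules. The support condition makes the prime of a nonzero summand an associate of some `F
j`. -/
theorem homLaw (hF : IsPrimeFamily F e) {X M : Type*} [AddCommGroup X] [Module K[X] X]
    [Module K X] [IsScalarTower K K[X] X] [Module.Finite K X] [AddCommGroup M] [Module K[X] M]
    [Module K M] [IsScalarTower K K[X] M] [Module.Finite K M] (hX : IsSupported F X) {n : ℕ}
    (hn : Module.finrank K X ≤ n) : HomLaw F e n X M := by
  classical
  have hprod : ∏ j, F j ≠ 0 := Finset.prod_ne_zero_iff.mpr fun j _ => (hF.irreducible j).ne_zero
  have : Module.Finite K[X] X := Module.Finite.of_restrictScalars_finite K K[X] X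
  have htors : Module.IsTorsion K[X] X := by
    obtain ⟨N, hN⟩ := hX
    intro x
    exact ⟨⟨_, mem_nonZeroDivisors_of_ne_zero (pow_ne_zero N hprod)⟩, hN x⟩
  obtain ⟨ι, _, p, hp, k, ⟨g⟩⟩ := Module.equiv_directSum_of_isTorsion htors
  let Y : ι → Type _ := fun s => K[X] ⧸ Ideal.span {p s ^ k s}
  let g' : X ≃ₗ[K[X]] ∀ s, Y s := g.trans (DirectSum.linearEquivFunOnFintype K[X] ι Y)
  have hfin : ∀ s, Module.Finite K (Y s) :=
    fun s => finite_quotient_span_singleton (pow_ne_zero _ (hp s).ne_zero)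
  refine HomLaw.of_linearEquiv g' (HomLaw.pi fun s => ?_)
  let π : X →ₗ[K[X]] Y s := LinearMap.proj (R := K[X]) (φ := Y) s ∘ₗ g'.toLinearMap
  have hsurj : Function.Surjective π := (LinearMap.proj_surjective (R := K[X]) (φ := Y) s).comp g'.surjective
  obtain ⟨N, hN⟩ := hX.of_surjective π hsurj
  -- A summand with exponent 0 vanishes, and its prime need not be among the `F j`.
  rcases Nat.eq_zero_or_pos (k s) with hk | hk
  · have : Subsingleton (Y s) := by
      refine Ideal.Quotient.subsingleton_iff.mpr ?_
      rw [hk, pow_zero, Ideal.span_singleton_one]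
    exact HomLaw.of_subsingleton
  have hdvd : p s ^ k s ∣ (∏ j, F j) ^ N := by
    have := hN (Ideal.Quotient.mk _ 1)
    change Ideal.Quotient.mk _ (_ * 1) = 0 at this
    rwa [mul_one, Ideal.Quotient.eq_zero_iff_mem, Ideal.mem_span_singleton] at this
  have hps : p s ∣ ∏ j, F j :=
    (hp s).prime.dvd_of_dvd_pow ((dvd_pow_self _ hk.ne').trans hdvd)
  obtain ⟨j, -, hj⟩ := (hp s).prime.exists_mem_finset_dvd hps
  have hassoc : Associated (p s) (F j) := (hp s).associated_of_dvd (hF.irreducible j) hj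
  have hspan : Ideal.span {p s ^ k s} = Ideal.span {F j ^ k s} :=
    Ideal.span_singleton_eq_span_singleton.mpr (hassoc.pow_pow (n := k s))
  refine HomLaw.of_linearEquiv (Submodule.quotEquivOfEq _ _ hspan) (HomLaw.cyclic hF j ?_)
  have hle : Module.finrank K (Y s) ≤ Module.finrank K X :=
    LinearMap.finrank_le_finrank_of_surjective (f := π.restrictScalars K) hsurj
  have hdeg : Module.finrank K (Y s) = k s * (p s).natDegree := by
    rw [finrank_quotient_span_eq_natDegree, natDegree_pow]
  have := Nat.le_mul_of_pos_right (k s) (hp s).natDegree_pos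
  omega

end CountingInjections

/-! ### Injections, and isomorphism of modules of equal type -/

section Injections

variable {Q : Type} [Fintype Q] {e : Q → ℕ}

/-- The number of proper quotients of given type is a rational function of `q`. -/
theorem card_proper_quotients_rational (he : ∀ j, 0 < e j) (x y : Q → ℕ → ℕ) : ∃ ρ : ℕ → ℚ,
    IsRational ρ ∧ ∀ (K : Type u) [Field K] [Finite K] (F : Q → K[X]), IsPrimeFamily F e →
      ∀ (X : Type u) [AddCommGroup X] [Module K[X] X] [Module K X] [IsScalarTower K K[X] X]
      [Module.Finite K X], IsSupported F X → relType F (⊥ : Submodule K[X] X) ⊤ = x →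
      (Nat.card {L : Submodule K[X] X // L ≠ ⊥ ∧ relType F L ⊤ = y} : ℚ) = ρ (Nat.card K) := by
  classical
  choose ρ hρ h using fun t => hallRational.{u} he x t y
  -- Sum the Hall numbers over all types of `L`, then remove `L = ⊥`, which is counted exactly when
  -- `x = y`.
  refine ⟨_, (IsRational.sum (typeBox Q (∑ j, x j 0)) fun t _ => hρ t).sub
    (IsRational.const (if x = y then 1 else 0)), ?_⟩
  rintro K _ _ F hF X _ _ _ _ _ hX rfl
  have : Finite X := Module.finite_of_finite K
  have e1 := card_eq_sum (fun L : Submodule K[X] X => relType F L ⊤ = y)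
    (fun L => relType F ⊥ L) (typeBox Q (∑ j, relType F (⊥ : Submodule K[X] X) ⊤ j 0))
    (fun L _ => relType_mem_typeBox_of_le F fun j => by
      have h1 := relType_zero F (bot_le (a := L)) j
      have h2 := relType_zero F (le_top (a := (⊥ : Submodule K[X] X))) j
      have h3 := kdim_mono (K := K) (le_top (a := L))
      have h4 := Finset.single_le_sum
        (f := fun j => relType F (⊥ : Submodule K[X] X) ⊤ j 0) (fun _ _ => Nat.zero_le _)
        (Finset.mem_univ j)
      omega)
  have e2 : ∀ t, (Nat.card {L : Submodule K[X] X // relType F L ⊤ = y ∧ relType F ⊥ L = t} : ℚ) =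
      ρ t (Nat.card K) := by
    intro t
    rw [← h t K F hF X ⊥ ⊤ hX bot_le rfl]
    congr 1
    refine Nat.card_congr (Equiv.subtypeEquivRight fun L => ?_)
    simp [and_comm]
  simp only [e2] at e1
  rw [← e1]
  have e3 := card_eq_sum (fun L : Submodule K[X] X => relType F L ⊤ = y)
    (fun L => decide (L = ⊥)) Finset.univ (fun _ _ => Finset.mem_univ _)
  rw [Fintype.sum_bool] at e3
  rw [e3]
  have e4 : (Nat.card {L : Submodule K[X] X // relType F L ⊤ = y ∧ decide (L = ⊥) = true} : ℚ) =
      if relType F (⊥ : Submodule K[X] X) ⊤ = y then 1 else 0 := by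
    split_ifs with hy
    · have : Unique {L : Submodule K[X] X // relType F L ⊤ = y ∧ decide (L = ⊥) = true} :=
        { default := ⟨⊥, hy, by simp⟩
          uniq := fun L => Subtype.ext (by simpa using L.2.2) }
      rw [Nat.card_unique, Nat.cast_one]
    · have : IsEmpty {L : Submodule K[X] X // relType F L ⊤ = y ∧ decide (L = ⊥) = true} := by
        refine ⟨fun ⟨L, h1, h2⟩ => hy ?_⟩
        obtain rfl : L = ⊥ := by simpa using h2
        exact h1
      rw [Nat.card_of_isEmpty, Nat.cast_zero]
  rw [e4, add_sub_cancel_left]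
  congr 1
  refine Nat.card_congr (Equiv.subtypeEquivRight fun L => ?_)
  simp [and_comm]

/-- Homomorphisms with kernel `L` are injections of the quotient. -/
theorem card_hom_ker_eq {R X M : Type*} [CommRing R] [AddCommGroup X] [Module R X]
    [AddCommGroup M] [Module R M] (L : Submodule R X) :
    Nat.card {φ : X →ₗ[R] M // LinearMap.ker φ = L} =
      Nat.card {ψ : (X ⧸ L) →ₗ[R] M // Function.Injective ψ} := by
  refine Nat.card_congr
    { toFun := fun φ => ⟨L.liftQ φ.1 φ.2.ge, ?_⟩
      invFun := fun ψ => ⟨ψ.1 ∘ₗ L.mkQ, ?_⟩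
      left_inv := fun φ => Subtype.ext (L.liftQ_mkQ _ _)
      right_inv := fun ψ => Subtype.ext (Submodule.linearMap_qext _ (L.liftQ_mkQ _ _)) }
  · rw [← LinearMap.ker_eq_bot, Submodule.ker_liftQ, φ.2, Submodule.mkQ_map_self]
  · rw [LinearMap.ker_comp, LinearMap.ker_eq_bot.mpr ψ.2, Submodule.comap_bot, Submodule.ker_mkQ]

/-- The number of injective homomorphisms between modules of given types is a rational function
of `q`. -/
theorem card_injections_rational (he : ∀ j, 0 < e j) (a : ℕ) : ∀ x m : Q → ℕ → ℕ, ∃ ρ : ℕ → ℚ,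
    IsRational ρ ∧ ∀ (K : Type u) [Field K] [Finite K] (F : Q → K[X]), IsPrimeFamily F e →
      ∀ (X : Type u) [AddCommGroup X] [Module K[X] X] [Module K X] [IsScalarTower K K[X] X]
      [Module.Finite K X] (M : Type u) [AddCommGroup M] [Module K[X] M] [Module K M]
      [IsScalarTower K K[X] M] [Module.Finite K M], IsSupported F X →
      Module.finrank K X ≤ a → relType F (⊥ : Submodule K[X] X) ⊤ = x →
      relType F (⊥ : Submodule K[X] M) ⊤ = m →
      (Nat.card {φ : X →ₗ[K[X]] M // Function.Injective φ} : ℚ) = ρ (Nat.card K) := by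
  classical
  induction a with
  | zero =>
    intro x m
    refine ⟨fun _ => 1, IsRational.const 1, ?_⟩
    rintro K _ _ F hF X _ _ _ _ _ M _ _ _ _ _ hX ha rfl rfl
    have : Subsingleton X := Module.finrank_zero_iff.mp (Nat.le_zero.mp ha)
    have : Unique {φ : X →ₗ[K[X]] M // Function.Injective φ} :=
      { default := ⟨0, Function.injective_of_subsingleton _⟩
        uniq := fun φ => Subtype.ext (LinearMap.ext fun y => by
          rw [Subsingleton.elim y 0, map_zero, map_zero]) }
    simp
  | succ a ih =>
    intro x m
    choose ρ₁ hρ₁ h₁ using fun y => card_proper_quotients_rational.{u} he x y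
    choose ρ₂ hρ₂ h₂ using fun y => ih y m
    -- All homomorphisms minus the non-injective ones, which are sorted by their kernel `L ≠ ⊥` and
    -- the type of `X / L`. The floor produces an exponent that depends on the types alone; for
    -- realized types it changes nothing.
    refine ⟨_, (IsRational.pow_self ⌊homExponent e (a + 1) x m⌋₊).sub
      (IsRational.sum (typeBox Q (a + 1)) fun y _ => (hρ₁ y).mul (hρ₂ y)), ?_⟩
    rintro K _ _ F hF X _ _ _ _ _ M _ _ _ _ _ hX ha hx hm
    have : Finite X := Module.finite_of_finite K
    have : Finite M := Module.finite_of_finite K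
    have : Finite (X →ₗ[K[X]] M) := DFunLike.finite _
    obtain ⟨k, hk1, hk2⟩ := homLaw hF (M := M) hX ha
    rw [hx, hm] at hk2
    rw [← hk2, Nat.floor_natCast, ← Nat.cast_pow, ← hk1, eq_sub_iff_add_eq]
    let S : Submodule K[X] X → (X →ₗ[K[X]] M) → Prop := fun L φ => L ≠ ⊥ ∧ LinearMap.ker φ = L
    have e1 := card_pairs_eq_sum S (fun L => L ≠ ⊥) (fun L => relType F L ⊤) (typeBox Q (a + 1)) (fun y => ρ₂ y (Nat.card K))
      (fun L φ h => h.1)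
      (fun L _ => relType_mem_typeBox F le_top (by rw [kdim_top]; omega))
      (fun L hL => by
        have hlt : Module.finrank K (X ⧸ L) ≤ a := by
          have h1 := kdim_map_mkQ_add (le_top (a := L))
          rw [Submodule.map_top, Submodule.range_mkQ, kdim_top, kdim_top] at h1
          have h2 := kdim_strictMono (K := K) (bot_lt_iff_ne_bot.mpr hL)
          rw [kdim_bot] at h2
          omega
        rw [← h₂ _ K F hF (X ⧸ L) M (hX.of_surjective L.mkQ L.mkQ_surjective) hlt
          (relType_quotient F L) hm, ← card_hom_ker_eq]
        congr 1
        exact Nat.card_congr (Equiv.subtypeEquivRight fun φ => by simp [S, hL]))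
    simp only [h₁ _ K F hF X hX hx] at e1
    rw [← e1, card_pairs_swap S]
    have e2 := card_pairs_eq_mul (fun φ L => S L φ) (fun φ => ¬ Function.Injective φ) 1
      (fun φ L h => by rw [← LinearMap.ker_eq_bot, h.2]; exact h.1)
      (fun φ hφ => by
        rw [← LinearMap.ker_eq_bot] at hφ
        have : Unique {L : Submodule K[X] X // L ≠ ⊥ ∧ LinearMap.ker φ = L} :=
          { default := ⟨LinearMap.ker φ, hφ, rfl⟩
            uniq := fun L => Subtype.ext L.2.2.symm }
        simp)
    rw [e2, mul_one, ← Nat.cast_add, ← Nat.card_sum]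
    congr 1
    exact Nat.card_congr (Equiv.sumCompl _)

/-- Modules of the same type are isomorphic. -/
theorem nonempty_linearEquiv_of_relType_eq (he : ∀ j, 0 < e j) {K : Type u} [Field K] [Finite K]
    {F : Q → K[X]} (hF : IsPrimeFamily F e) {X M : Type u} [AddCommGroup X] [Module K[X] X]
    [Module K X] [IsScalarTower K K[X] X] [Module.Finite K X] [AddCommGroup M] [Module K[X] M]
    [Module K M] [IsScalarTower K K[X] M] [Module.Finite K M] (hX : IsSupported F X)
    (hdim : Module.finrank K X = Module.finrank K M)
    (h : relType F (⊥ : Submodule K[X] X) ⊤ = relType F (⊥ : Submodule K[X] M) ⊤) :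
    Nonempty (X ≃ₗ[K[X]] M) := by
  -- Injections `X → X` and `X → M` are equally numerous because the types agree. The identity shows
  -- that there is one, and equal dimensions make it bijective.
  obtain ⟨ρ, -, hρ⟩ := card_injections_rational.{u} he (Module.finrank K X)
    (relType F (⊥ : Submodule K[X] X) ⊤) (relType F (⊥ : Submodule K[X] X) ⊤)
  have h1 := hρ K F hF X X hX le_rfl rfl rfl
  have h2 := hρ K F hF X M hX le_rfl rfl h.symm
  have : Finite X := Module.finite_of_finite K
  have : Finite (X →ₗ[K[X]] X) := DFunLike.finite _
  have h3 : Nonempty {φ : X →ₗ[K[X]] X // Function.Injective φ} :=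
    ⟨LinearMap.id, Function.injective_id⟩
  have h4 : Nat.card {φ : X →ₗ[K[X]] M // Function.Injective φ} ≠ 0 := by
    have : Nat.card {φ : X →ₗ[K[X]] X // Function.Injective φ} ≠ 0 := Nat.card_pos.ne'
    have h5 := h2.trans h1.symm
    rw [Nat.cast_inj] at h5
    rwa [h5]
  obtain ⟨⟨φ, hφ⟩⟩ := (Nat.card_ne_zero.mp h4).1
  refine ⟨LinearEquiv.ofBijective φ ⟨hφ, ?_⟩⟩
  exact (LinearMap.injective_iff_surjective_of_finrank_eq_finrank
    (f := φ.restrictScalars K) hdim).mp hφ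

end Injections

/-! ### Flags -/

section LinearFlags

variable {K V M : Type*} [Field K] [AddCommGroup V] [Module K V] [AddCommGroup M] [Module K M]

theorem card_linearEquiv_map_flag_eq {l : ℕ} (U : Fin (l + 1) → Submodule K V)
    (W : Fin (l + 1) → Submodule K M) (h₀ : V ≃ₗ[K] M)
    (h₀' : ∀ i, (U i).map (h₀ : V →ₗ[K] M) = W i) :
    Nat.card {h : V ≃ₗ[K] M // ∀ i, (U i).map (h : V →ₗ[K] M) = W i} =
      Nat.card {h : V ≃ₗ[K] V // ∀ i, (U i).map (h : V →ₗ[K] V) = U i} := by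
  refine Nat.card_congr (Equiv.symm
    { toFun := fun h => ⟨h.1.trans h₀, fun i => ?_⟩
      invFun := fun h => ⟨h.1.trans h₀.symm, fun i => ?_⟩
      left_inv := fun h => by ext; simp
      right_inv := fun h => by ext; simp })
  · rw [LinearEquiv.coe_trans, Submodule.map_comp, h.2, h₀']
  · rw [LinearEquiv.coe_trans, Submodule.map_comp, h.2, ← h₀', ← Submodule.map_comp,
      ← LinearEquiv.coe_trans]
    simp

variable [Module.Finite K V] [Module.Finite K M]

theorem exists_linearEquiv_extending {T : Submodule K V} (φ : T →ₗ[K] M)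
    (hφ : Function.Injective φ) (hVM : Module.finrank K V = Module.finrank K M) :
    ∃ h : V ≃ₗ[K] M, ∀ x : T, h x = φ x := by
  obtain ⟨C, hC⟩ := T.exists_isCompl
  obtain ⟨C', hC'⟩ := (LinearMap.range φ).exists_isCompl
  let φ' : T ≃ₗ[K] LinearMap.range φ := LinearEquiv.ofInjective φ hφ
  have hdim : Module.finrank K C = Module.finrank K C' := by
    have h1 := Submodule.finrank_add_eq_of_isCompl hC
    have h2 := Submodule.finrank_add_eq_of_isCompl hC'
    have h3 := φ'.finrank_eq
    omega
  let ψ : C ≃ₗ[K] C' := LinearEquiv.ofFinrankEq _ _ hdim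
  refine ⟨(Submodule.prodEquivOfIsCompl _ _ hC).symm.trans
    ((φ'.prodCongr ψ).trans (Submodule.prodEquivOfIsCompl _ _ hC')), fun x => ?_⟩
  simp [φ']

/-- The inductive step for transitivity on flags: `h` is altered only outside `T`, so the smaller
members already in place stay there. -/
theorem exists_linearEquiv_map_eq {T A : Submodule K V} {A' : Submodule K M} (h : V ≃ₗ[K] M)
    (hA : T ≤ A) (hA' : T.map (h : V →ₗ[K] M) ≤ A')
    (hdim : Module.finrank K A = Module.finrank K A') :
    ∃ h' : V ≃ₗ[K] M, (∀ x ∈ T, h' x = h x) ∧ A.map (h' : V →ₗ[K] M) = A' := by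
  let φ : T.submoduleOf A →ₗ[K] A' :=
    ((h : V →ₗ[K] M) ∘ₗ A.subtype ∘ₗ (T.submoduleOf A).subtype).codRestrict A'
      fun x => hA' ⟨x.1.1, x.2, rfl⟩
  have hφ : Function.Injective φ := fun x y hxy =>
    Subtype.ext (Subtype.ext (h.injective (congrArg Subtype.val hxy)))
  obtain ⟨g, hg⟩ := exists_linearEquiv_extending φ hφ hdim
  obtain ⟨h', hh'⟩ := exists_linearEquiv_extending (A'.subtype ∘ₗ g.toLinearMap)
    (A'.injective_subtype.comp g.injective) h.finrank_eq
  refine ⟨h', fun x hx => ?_, ?_⟩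
  · rw [hh' ⟨x, hA hx⟩]
    exact congrArg Subtype.val (hg ⟨⟨x, hA hx⟩, hx⟩)
  · ext y
    constructor
    · rintro ⟨x, hx, rfl⟩
      change h' x ∈ A'
      rw [hh' ⟨x, hx⟩]
      exact (g ⟨x, hx⟩).2
    · intro hy
      refine ⟨(g.symm ⟨y, hy⟩).1, (g.symm ⟨y, hy⟩).2, ?_⟩
      change h' _ = y
      rw [hh']
      simp

theorem exists_linearEquiv_map_flag_eq {l : ℕ} (U : Fin (l + 1) → Submodule K V)
    (W : Fin (l + 1) → Submodule K M) (hU : ∀ i : Fin l, U i.castSucc ≤ U i.succ)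
    (hW : ∀ i : Fin l, W i.castSucc ≤ W i.succ)
    (hdim : ∀ i, Module.finrank K (U i) = Module.finrank K (W i))
    (hVM : Module.finrank K V = Module.finrank K M) :
    ∃ h : V ≃ₗ[K] M, ∀ i, (U i).map (h : V →ₗ[K] M) = W i := by
  have hmono : Monotone U := Fin.monotone_iff_le_succ.mpr hU
  suffices H : ∀ i, ∃ h : V ≃ₗ[K] M, ∀ j ≤ i, (U j).map (h : V →ₗ[K] M) = W j by
    obtain ⟨h, hh⟩ := H (Fin.last l)
    exact ⟨h, fun i => hh i (Fin.le_last i)⟩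
  intro i
  induction i using Fin.induction with
  | zero =>
    obtain ⟨h, -, hh⟩ := exists_linearEquiv_map_eq (LinearEquiv.ofFinrankEq V M hVM)
      (bot_le (a := U 0)) (by simp) (hdim 0)
    refine ⟨h, fun j hj => ?_⟩
    rw [Fin.le_zero_iff.mp hj, hh]
  | succ i ih =>
    obtain ⟨h, hh⟩ := ih
    obtain ⟨h', h1, h2⟩ := exists_linearEquiv_map_eq h (hU i)
      ((hh _ le_rfl).le.trans (hW i)) (hdim i.succ)
    refine ⟨h', fun j hj => ?_⟩
    rcases eq_or_lt_of_le hj with rfl | hlt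
    · exact h2
    · have hji : j ≤ i.castSucc := Fin.le_castSucc_iff.mpr hlt
      rw [← hh j hji]
      ext y
      simp only [Submodule.mem_map]
      refine exists_congr fun x => and_congr_right fun hx => ?_
      have := h1 x (hmono hji hx)
      simp [this]

end LinearFlags

/-! ### Isomorphisms carrying a linear flag to a flag of submodules -/

section ModuleFlags

variable {K V Q : Type*} [Field K] [AddCommGroup V] [Module K V]

/-- `W` is a chain of submodules from `⊥` to `⊤` with successive quotients of types `b i`. -/
def IsTypedFlag {M : Type*} [AddCommGroup M] [Module K M] [Module K[X] M] [IsScalarTower K K[X] M]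
    (F : Q → K[X]) {l : ℕ} (b : Fin l → Q → ℕ → ℕ) (W : Fin (l + 1) → Submodule K[X] M) : Prop :=
  W 0 = ⊥ ∧ W (Fin.last l) = ⊤ ∧ (∀ i : Fin l, W i.castSucc ≤ W i.succ) ∧
    ∀ i : Fin l, relType F (W i.castSucc) (W i.succ) = b i

/-- `h` carries the flag `U` to a flag of `K[X]`-submodules of type `b`. -/
def CarriesToTypedFlag {M : Type*} [AddCommGroup M] [Module K M] [Module K[X] M]
    [IsScalarTower K K[X] M] (F : Q → K[X]) {l : ℕ} (b : Fin l → Q → ℕ → ℕ)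
    (U : Fin (l + 1) → Submodule K V) (h : V ≃ₗ[K] M) : Prop :=
  ∃ W : Fin (l + 1) → Submodule K[X] M, IsTypedFlag F b W ∧
    ∀ i, (U i).map (h : V →ₗ[K] M) = (W i).restrictScalars K

variable {F : Q → K[X]} {l : ℕ} {b : Fin l → Q → ℕ → ℕ} {U : Fin (l + 1) → Submodule K V}

theorem CarriesToTypedFlag.trans {M M' : Type*} [AddCommGroup M] [Module K M] [Module K[X] M]
    [IsScalarTower K K[X] M] [AddCommGroup M'] [Module K M'] [Module K[X] M']
    [IsScalarTower K K[X] M'] {h : V ≃ₗ[K] M} (hh : CarriesToTypedFlag F b U h)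
    (g : M ≃ₗ[K[X]] M') : CarriesToTypedFlag F b U (h.trans (g.restrictScalars K)) := by
  obtain ⟨W, ⟨h0, hl, hle, ht⟩, hW⟩ := hh
  refine ⟨fun i => (W i).map g.toLinearMap, ⟨?_, ?_, fun i => Submodule.map_mono (hle i),
    fun i => ?_⟩, fun i => ?_⟩
  · simp [h0]
  · simp [hl]
  · rw [relType_map_of_injective F _ g.injective, ht]
  · ext x
    have := fun y => congrArg (fun N => y ∈ N) (hW i)
    simp only [Submodule.mem_map, Submodule.restrictScalars_mem, eq_iff_iff] at this
    simp only [Submodule.mem_map, Submodule.restrictScalars_mem, ← this]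
    constructor
    · rintro ⟨y, hy, rfl⟩
      exact ⟨h y, ⟨y, hy, rfl⟩, rfl⟩
    · rintro ⟨_, ⟨y, hy, rfl⟩, rfl⟩
      exact ⟨y, hy, rfl⟩

variable [Finite K] [Module.Finite K V]

/-- Sort the `h` by the flag `W` they produce. The types fix the dimensions in `W`, so some `h`
reaches it, and the fibre is a torsor under the stabilizer of `U`. -/
theorem card_carriesToTypedFlag {M : Type*} [AddCommGroup M] [Module K M] [Module K[X] M]
    [IsScalarTower K K[X] M] [Module.Finite K M] {d : Fin l → ℕ} (hU0 : U 0 = ⊥)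
    (hU : ∀ i : Fin l, U i.castSucc ≤ U i.succ)
    (hUd : ∀ i : Fin l, Module.finrank K (U i.succ) = Module.finrank K (U i.castSucc) + d i)
    (hb : ∀ i, ∃ j, b i j 0 = d i) (hVM : Module.finrank K V = Module.finrank K M) :
    (Nat.card {h : V ≃ₗ[K] M // CarriesToTypedFlag F b U h} : ℚ) =
      Nat.card {W : Fin (l + 1) → Submodule K[X] M // IsTypedFlag F b W} *
        Nat.card {h : V ≃ₗ[K] V // ∀ i, (U i).map (h : V →ₗ[K] V) = U i} := by
  have : Finite M := Module.finite_of_finite K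
  have : Finite V := Module.finite_of_finite K
  have : Finite (V ≃ₗ[K] M) := DFunLike.finite _
  let S : (Fin (l + 1) → Submodule K[X] M) → (V ≃ₗ[K] M) → Prop := fun W h =>
    IsTypedFlag F b W ∧ ∀ i, (U i).map (h : V →ₗ[K] M) = (W i).restrictScalars K
  rw [← card_pairs_eq_mul S (fun W => IsTypedFlag F b W) _ (fun W h hS => hS.1), card_pairs_swap S]
  · rw [card_pairs_eq_mul (fun h W => S W h) (fun h => CarriesToTypedFlag F b U h) 1
      (fun h W hS => ⟨W, hS⟩), mul_one]
    rintro h ⟨W, hW⟩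
    have : Unique {W // S W h} :=
      { default := ⟨W, hW⟩
        uniq := fun W' => Subtype.ext (funext fun i => Submodule.restrictScalars_injective K _ _
          ((W'.2.2 i).symm.trans (hW.2 i))) }
    simp
  · intro W hW
    have hdim : ∀ i, Module.finrank K (U i) = kdim (W i) := by
      intro i
      induction i using Fin.induction with
      | zero => rw [hU0, hW.1, finrank_bot, kdim_bot]
      | succ i ih =>
        obtain ⟨j, hj⟩ := hb i
        rw [hUd, ih, relType_zero F (hW.2.2.1 i) j, hW.2.2.2 i, hj]
    obtain ⟨h₀, h₀'⟩ := exists_linearEquiv_map_flag_eq U (fun i => (W i).restrictScalars K) hU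
      hW.2.2.1 hdim hVM
    rw [← card_linearEquiv_map_flag_eq U (fun i => (W i).restrictScalars K) h₀ h₀']
    congr 1
    exact Nat.card_congr (Equiv.subtypeEquivRight fun h => by simp [S, hW])

end ModuleFlags

/-! ### Endomorphisms as `K[X]`-module structures -/

section Endomorphisms

variable {K V : Type*} [Field K] [AddCommGroup V] [Module K V]

theorem map_polynomial_smul {M M' : Type*} [AddCommGroup M] [Module K M] [Module K[X] M]
    [IsScalarTower K K[X] M] [AddCommGroup M'] [Module K M'] [Module K[X] M']
    [IsScalarTower K K[X] M'] (f : M →ₗ[K] M') (hf : ∀ x, f ((X : K[X]) • x) = (X : K[X]) • f x)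
    (p : K[X]) (x : M) : f (p • x) = p • f x := by
  induction p using Polynomial.induction_on generalizing x with
  | C a =>
    rw [← Polynomial.algebraMap_eq, algebraMap_smul, algebraMap_smul, map_smul]
  | add p q hp hq => rw [add_smul, map_add, hp, hq, add_smul]
  | monomial n a ih => rw [pow_succ, ← mul_assoc, mul_smul, ih, hf, ← mul_smul]

/-- The endomorphism of `V` that corresponds to the action of `X` on `M`. -/
noncomputable def transportX {M : Type*} [AddCommGroup M] [Module K M] [Module K[X] M]
    [IsScalarTower K K[X] M] (h : V ≃ₗ[K] M) : Module.End K V :=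
  h.symm.toLinearMap ∘ₗ (LinearMap.lsmul K[X] M X).restrictScalars K ∘ₗ h.toLinearMap

theorem apply_transportX {M : Type*} [AddCommGroup M] [Module K M] [Module K[X] M]
    [IsScalarTower K K[X] M] (h : V ≃ₗ[K] M) (v : V) : h (transportX h v) = (X : K[X]) • h v := by
  simp [transportX]

theorem transportX_eq_zero {M : Type*} [AddCommGroup M] [Module K M] [Module K[X] M]
    [IsScalarTower K K[X] M] (hM : ∀ x : M, (X : K[X]) • x = 0) (h : V ≃ₗ[K] M) :
    transportX h = 0 := by
  ext v
  apply h.injective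
  rw [apply_transportX, hM, LinearMap.zero_apply, map_zero]

/-- Linear equivalences that transport `X` to `p` are isomorphisms of `K[X]`-modules. -/
noncomputable def equivTransportX {M : Type*} [AddCommGroup M] [Module K M] [Module K[X] M]
    [IsScalarTower K K[X] M] (p : Module.End K V) :
    {h : V ≃ₗ[K] M // transportX h = p} ≃ (Module.AEval' p ≃ₗ[K[X]] M) where
  toFun h := LinearEquiv.ofAEval p h.1 fun m => by
    rw [← apply_transportX, h.2]
    rfl
  invFun g := ⟨(Module.AEval'.of p).trans (g.restrictScalars K), by
    ext v
    apply ((Module.AEval'.of p).trans (g.restrictScalars K)).injective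
    rw [apply_transportX]
    simp [← map_smul, Module.AEval'.X_smul_of]⟩
  left_inv h := by
    ext
    rfl
  right_inv g := by
    ext
    rfl

/-- A subspace stable under `p` as a `K[X]`-submodule. -/
noncomputable def stableSubmodule (p : Module.End K V) (U : Submodule K V)
    (h : ∀ v ∈ U, p v ∈ U) : Submodule K[X] (Module.AEval' p) where
  carrier := {x | (Module.AEval'.of p).symm x ∈ U}
  zero_mem' := by simp
  add_mem' := fun {x y} hx hy => by
    simp only [Set.mem_ofPred_eq, map_add] at *
    exact U.add_mem hx hy
  smul_mem' := fun f x hx => by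
    simp only [Set.mem_ofPred_eq] at *
    obtain ⟨v, rfl⟩ := (Module.AEval'.of p).surjective x
    rw [LinearEquiv.symm_apply_apply] at hx
    induction f using Polynomial.induction_on generalizing v with
    | C a =>
      rw [← Polynomial.algebraMap_eq, algebraMap_smul, map_smul, LinearEquiv.symm_apply_apply]
      exact U.smul_mem a hx
    | add f g hf hg =>
      rw [add_smul, map_add]
      exact U.add_mem (hf v hx) (hg v hx)
    | monomial n a ih =>
      rw [pow_succ, ← mul_assoc, mul_smul, Module.AEval'.X_smul_of]
      exact ih _ (h v hx)

@[simp] theorem of_mem_stableSubmodule {p : Module.End K V} {U : Submodule K V}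
    {h : ∀ v ∈ U, p v ∈ U} {v : V} : Module.AEval'.of p v ∈ stableSubmodule p U h ↔ v ∈ U :=
  Iff.rfl

theorem of_mem_map_of (p : Module.End K V) (U : Submodule K V) (v : V) :
    Module.AEval'.of p v ∈ U.map (Module.AEval'.of p : V →ₗ[K] Module.AEval' p) ↔ v ∈ U :=
  Submodule.mem_map.trans ⟨fun ⟨w, hw, h⟩ => by
    rwa [← (Module.AEval'.of p).injective h], fun h => ⟨v, h, rfl⟩⟩

theorem map_of_eq_stableSubmodule (p : Module.End K V) (U : Submodule K V)
    (h : ∀ v ∈ U, p v ∈ U) : U.map (Module.AEval'.of p : V →ₗ[K] Module.AEval' p) =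
      (stableSubmodule p U h).restrictScalars K := by
  ext x
  obtain ⟨v, rfl⟩ := (Module.AEval'.of p).surjective x
  rw [Submodule.restrictScalars_mem, of_mem_stableSubmodule, of_mem_map_of]

theorem kdim_stableSubmodule (p : Module.End K V) (U : Submodule K V) (h : ∀ v ∈ U, p v ∈ U) :
    kdim (stableSubmodule p U h) = Module.finrank K U := by
  unfold kdim
  rw [← map_of_eq_stableSubmodule]
  exact LinearEquiv.finrank_map_eq _ _

/-- Sort the `h` by `transportX h`. The fibre over `p` consists of the module isomorphisms from
`Module.AEval' p` to `M`, a torsor under the automorphisms of `M`. -/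
theorem card_conjugates_mul_card_aut [Finite K] [Module.Finite K V] {M : Type*} [AddCommGroup M]
    [Module K M] [Module K[X] M] [IsScalarTower K K[X] M] [Module.Finite K M]
    (C : (V ≃ₗ[K] M) → Prop) (C' : Module.End K V → Prop)
    (hC : ∀ h, C h ↔ C' (transportX h)) :
    (Nat.card {h : V ≃ₗ[K] M // C h} : ℚ) =
      Nat.card {p : Module.End K V // Nonempty (Module.AEval' p ≃ₗ[K[X]] M) ∧ C' p} *
        Nat.card (M ≃ₗ[K[X]] M) := by
  have : Finite M := Module.finite_of_finite K
  have : Finite V := Module.finite_of_finite K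
  have : Finite (V ≃ₗ[K] M) := DFunLike.finite _
  have : Finite (Module.End K V) := DFunLike.finite _
  let S : Module.End K V → (V ≃ₗ[K] M) → Prop := fun p h => C h ∧ transportX h = p
  rw [← card_pairs_eq_mul S (fun p => Nonempty (Module.AEval' p ≃ₗ[K[X]] M) ∧ C' p),
    card_pairs_swap S]
  · rw [card_pairs_eq_mul (fun h p => S p h) C 1 (fun h p hS => hS.1), mul_one]
    intro h hh
    simp [S, hh]
  · rintro p h ⟨hh, rfl⟩
    exact ⟨⟨equivTransportX _ ⟨h, rfl⟩⟩, (hC h).mp hh⟩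
  · rintro p ⟨⟨g⟩, hp⟩
    have e1 : (Module.AEval' p ≃ₗ[K[X]] M) ≃ (M ≃ₗ[K[X]] M) :=
      { toFun := fun h => g.symm.trans h
        invFun := fun h => g.trans h
        left_inv := fun h => by ext; simp
        right_inv := fun h => by ext; simp }
    rw [← Nat.card_congr e1, ← Nat.card_congr (equivTransportX p)]
    congr 1
    refine Nat.card_congr (Equiv.subtypeEquivRight fun h => ⟨fun hS => hS.2, fun hh => ⟨?_, hh⟩⟩)
    rw [hC, hh]
    exact hp

theorem card_linearEquiv_self_eq_card_injective {R M : Type*} [Semiring R] [AddCommMonoid M]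
    [Module R M] [Finite M] :
    Nat.card (M ≃ₗ[R] M) = Nat.card {φ : M →ₗ[R] M // Function.Injective φ} :=
  Nat.card_congr
    { toFun := fun g => ⟨g.toLinearMap, g.injective⟩
      invFun := fun φ => LinearEquiv.ofBijective φ.1 (Finite.injective_iff_bijective.mp φ.2)
      left_inv := fun g => by ext; rfl
      right_inv := fun φ => by ext; rfl }

end Endomorphisms

section FinalCount

variable {K V Q : Type*} [Field K] [AddCommGroup V] [Module K V]
  {F : Q → K[X]} {l : ℕ} {b : Fin l → Q → ℕ → ℕ} {U : Fin (l + 1) → Submodule K V}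

theorem carriesToTypedFlag_of_iff (hU0 : U 0 = ⊥) (hUl : U (Fin.last l) = ⊤)
    (hU : ∀ i : Fin l, U i.castSucc ≤ U i.succ) (p : Module.End K V) :
    CarriesToTypedFlag F b U (Module.AEval'.of p) ↔ ∃ h : ∀ i, ∀ v ∈ U i, p v ∈ U i,
      ∀ i : Fin l, relType F (stableSubmodule p (U i.castSucc) (h _))
        (stableSubmodule p (U i.succ) (h _)) = b i := by
  constructor
  · rintro ⟨W, ⟨h0, hl, hle, ht⟩, hW⟩
    have hmem : ∀ i v, v ∈ U i ↔ Module.AEval'.of p v ∈ W i := by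
      intro i v
      rw [← of_mem_map_of p, hW i, Submodule.restrictScalars_mem]
    have hst : ∀ i, ∀ v ∈ U i, p v ∈ U i := by
      intro i v hv
      rw [hmem, ← Module.AEval'.X_smul_of]
      exact (W i).smul_mem _ ((hmem i v).mp hv)
    refine ⟨hst, fun i => ?_⟩
    have hWs : ∀ i, stableSubmodule p (U i) (hst i) = W i := by
      intro i
      apply Submodule.restrictScalars_injective K
      rw [← map_of_eq_stableSubmodule, hW]
    rw [hWs, hWs, ht]
  · rintro ⟨h, ht⟩
    refine ⟨fun i => stableSubmodule p (U i) (h i), ⟨?_, ?_, fun i x hx => hU i hx, ht⟩,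
      fun i => map_of_eq_stableSubmodule p (U i) (h i)⟩
    · rw [eq_bot_iff]
      intro x hx
      have : (Module.AEval'.of p).symm x ∈ U 0 := hx
      rw [hU0, Submodule.mem_bot, LinearEquiv.map_eq_zero_iff] at this
      exact this
    · rw [eq_top_iff]
      intro x _
      change (Module.AEval'.of p).symm x ∈ U (Fin.last l)
      rw [hUl]
      exact Submodule.mem_top

/-- The condition on `h` depends only on the endomorphism it induces on `V`, as the count by fibres
of `transportX` requires. -/
theorem carriesToTypedFlag_transportX {M : Type*} [AddCommGroup M] [Module K M] [Module K[X] M]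
    [IsScalarTower K K[X] M] (h : V ≃ₗ[K] M) :
    CarriesToTypedFlag F b U h ↔
      CarriesToTypedFlag F b U (Module.AEval'.of (transportX h)) := by
  let g : Module.AEval' (transportX h) ≃ₗ[K[X]] M := equivTransportX _ ⟨h, rfl⟩
  constructor
  · intro hh
    have := hh.trans g.symm
    convert this using 1
    ext v
    change _ = g.symm (h v)
    rw [LinearEquiv.eq_symm_apply]
    rfl
  · intro hh
    have := hh.trans g
    convert this using 1
    ext v
    rfl

/-- The type of a module of dimension `n` killed by `X`. -/
def trivialType (n : ℕ) : Unit → ℕ → ℕ := fun _ k => if k = 0 then n else 0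

theorem relType_eq_trivialType {M : Type*} [AddCommGroup M] [Module K M] [Module K[X] M]
    [IsScalarTower K K[X] M] [Module.Finite K M] (hM : ∀ x : M, (X : K[X]) • x = 0)
    {A B : Submodule K[X] M} (h : A ≤ B) {n : ℕ} (hn : kdim B = kdim A + n) :
    relType (fun _ : Unit => (X : K[X])) A B = trivialType n := by
  funext j k
  have h0 := relType_zero (fun _ : Unit => (X : K[X])) h j
  cases k with
  | zero =>
    simp only [trivialType, ↓reduceIte]
    omega
  | succ k =>
    have h1 : (X : K[X]) ^ (k + 1) • B ≤ A := by
      intro x hx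
      obtain ⟨y, -, rfl⟩ := (Submodule.mem_smul_pointwise_iff_exists _ _ _).mp hx
      rw [pow_succ, mul_smul, hM, smul_zero]
      exact A.zero_mem
    simp [relType, trivialType, sup_eq_right.mpr h1]

theorem isPrimeFamily_X : IsPrimeFamily (fun _ : Unit => (X : K[X])) fun _ => 1 where
  irreducible _ := irreducible_X
  natDegree_eq _ := natDegree_X
  isCoprime i j h := absurd (Subsingleton.elim i j) h

end FinalCount

/-- The endomorphisms in a given similarity class that preserve a flag and act on its quotients
with given types are counted by a quotient of rational functions of `q`. -/
theorem card_flag_endomorphisms_rational {Q : Type} [Fintype Q] {e : Q → ℕ} (he : ∀ j, 0 < e j)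
    {l : ℕ} (d : Fin l → ℕ) (n : ℕ) (m : Q → ℕ → ℕ) (b : Fin l → Q → ℕ → ℕ)
    (hb : ∀ i, ∃ j, b i j 0 = d i) : ∃ α β : ℕ → ℚ, IsRational α ∧ IsRational β ∧
    ∀ (K : Type u) [Field K] [Finite K] (F : Q → K[X]), IsPrimeFamily F e →
      ∀ (V : Type u) [AddCommGroup V] [Module K V] [Module.Finite K V]
      (U : Fin (l + 1) → Submodule K V), U 0 = ⊥ → (∀ i : Fin l, U i.castSucc ≤ U i.succ) →
      (∀ i : Fin l, Module.finrank K (U i.succ) = Module.finrank K (U i.castSucc) + d i) →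
      U (Fin.last l) = ⊤ → Module.finrank K V = n →
      ∀ (M : Type u) [AddCommGroup M] [Module K[X] M] [Module K M] [IsScalarTower K K[X] M]
      [Module.Finite K M], IsSupported F M → Module.finrank K M = n →
      relType F (⊥ : Submodule K[X] M) ⊤ = m →
      β (Nat.card K) ≠ 0 ∧
      (Nat.card {p : Module.End K V // Nonempty (Module.AEval' p ≃ₗ[K[X]] M) ∧
        CarriesToTypedFlag F b U (Module.AEval'.of p)} : ℚ) * β (Nat.card K) =
        α (Nat.card K) := by
  obtain ⟨ρ₁, hρ₁, h₁⟩ := card_chains_rational.{u} he l m b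
  obtain ⟨ρ₂, hρ₂, h₂⟩ := card_injections_rational.{u} he n m m
  obtain ⟨ρ₃, hρ₃, h₃⟩ := card_chains_rational.{u} (e := fun _ : Unit => 1) (fun _ => one_pos) l
    (trivialType n) fun i => trivialType (d i)
  obtain ⟨ρ₄, hρ₄, h₄⟩ := card_injections_rational.{u} (e := fun _ : Unit => 1) (fun _ => one_pos) n
    (trivialType n) (trivialType n)
  -- With #`p` · `ρ₂` = `ρ₁` · |Par| and `ρ₄` = `ρ₃` · |Par|, the unknown |Par| cancels to #`p` ·
  -- (`ρ₂` `ρ₃`) = `ρ₁` `ρ₄`.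
  refine ⟨_, _, hρ₁.mul hρ₄, hρ₂.mul hρ₃, ?_⟩
  intro K _ _ F hF V _ _ _ U hU0 hU hUd hUl hV M _ _ _ _ _ hM hMn hm
  have : Finite M := Module.finite_of_finite K
  -- The auxiliary module: `V` with `X` acting as zero, a module over the single prime `X`, where
  -- typed flags are just linear flags with steps `d`.
  let M₀ := Module.AEval' (0 : Module.End K V)
  have : Finite M₀ := Module.finite_of_finite K
  have hX : ∀ x : M₀, (X : K[X]) • x = 0 := by
    intro x
    obtain ⟨v, rfl⟩ := (Module.AEval'.of (0 : Module.End K V)).surjective x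
    rw [Module.AEval'.X_smul_of, LinearMap.zero_apply, map_zero]
  have hM₀ : IsSupported (fun _ : Unit => (X : K[X])) M₀ := ⟨1, fun x => by simp [hX]⟩
  have hM₀n : Module.finrank K M₀ = n :=
    (Module.AEval'.of (0 : Module.End K V)).finrank_eq.symm.trans hV
  have hm₀ : relType (fun _ : Unit => (X : K[X])) (⊥ : Submodule K[X] M₀) ⊤ = trivialType n :=
    relType_eq_trivialType hX bot_le (by rw [kdim_top, kdim_bot, hM₀n, zero_add])
  have a1 := h₁ K F hF M ⊥ ⊤ hM bot_le hm
  have a2 := h₂ K F hF M M hM hMn.le hm hm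
  have a3 := h₃ K _ isPrimeFamily_X M₀ ⊥ ⊤ hM₀ bot_le hm₀
  have a4 := h₄ K _ isPrimeFamily_X M₀ M₀ hM₀ hM₀n.le hm₀ hm₀
  rw [← card_linearEquiv_self_eq_card_injective] at a2 a4
  have b1 := card_carriesToTypedFlag (F := F) hU0 hU hUd hb (hV.trans hMn.symm)
  have b2 := card_carriesToTypedFlag (M := M₀) (F := fun _ : Unit => (X : K[X]))
    (b := fun i => trivialType (d i)) hU0 hU hUd
    (fun i => ⟨(), rfl⟩) (hV.trans hM₀n.symm)
  have c1 := card_conjugates_mul_card_aut (CarriesToTypedFlag F b U (M := M))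
    (fun p => CarriesToTypedFlag F b U (Module.AEval'.of p)) carriesToTypedFlag_transportX
  have c2 := card_conjugates_mul_card_aut (V := V) (M := M₀)
    (CarriesToTypedFlag (fun _ : Unit => (X : K[X])) (fun i => trivialType (d i)) U)
    (fun p => CarriesToTypedFlag (fun _ : Unit => (X : K[X])) (fun i => trivialType (d i)) U
      (Module.AEval'.of p)) carriesToTypedFlag_transportX
  have hall : CarriesToTypedFlag (fun _ : Unit => (X : K[X])) (fun i => trivialType (d i)) U
      (Module.AEval'.of (0 : Module.End K V)) := by
    rw [carriesToTypedFlag_of_iff hU0 hUl hU]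
    refine ⟨fun i v _ => (U i).zero_mem, fun i => ?_⟩
    exact relType_eq_trivialType hX (fun x hx => hU i hx)
      (by rw [kdim_stableSubmodule, kdim_stableSubmodule, hUd])
  have hone : Nat.card {p : Module.End K V // Nonempty (Module.AEval' p ≃ₗ[K[X]] M₀) ∧
      CarriesToTypedFlag (fun _ : Unit => (X : K[X])) (fun i => trivialType (d i)) U
        (Module.AEval'.of p)} = 1 := by
    rw [Nat.card_eq_one_iff_unique]
    refine ⟨⟨?_⟩, ⟨0, ⟨LinearEquiv.refl _ _⟩, hall⟩⟩
    have hzero : ∀ p : Module.End K V, Nonempty (Module.AEval' p ≃ₗ[K[X]] M₀) → p = 0 := by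
      rintro p ⟨g⟩
      have h := ((equivTransportX p).symm g).2
      rw [← h, transportX_eq_zero hX]
    rintro ⟨p, hp, -⟩ ⟨p', hp', -⟩
    exact Subtype.ext ((hzero p hp).trans (hzero p' hp').symm)
  rw [hone, Nat.cast_one, one_mul] at c2
  unfold IsTypedFlag at b1 b2
  rw [a1, c1, a2] at b1
  rw [a3, c2, a4] at b2
  -- `ρ₂` and `ρ₄` are orders of automorphism groups; `ρ₃` is nonzero because it divides `ρ₄`.
  have hA : ρ₂ (Nat.card K) ≠ 0 := by
    rw [← a2]
    have : Finite (M ≃ₗ[K[X]] M) := DFunLike.finite _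
    exact_mod_cast Nat.card_pos.ne'
  have hA0 : ρ₄ (Nat.card K) ≠ 0 := by
    rw [← a4]
    have : Finite (M₀ ≃ₗ[K[X]] M₀) := DFunLike.finite _
    exact_mod_cast Nat.card_pos.ne'
  refine ⟨mul_ne_zero hA ?_, ?_⟩
  · intro h0
    rw [h0, zero_mul] at b2
    exact hA0 b2
  · rw [← mul_assoc, b1, b2]
    ring

/-! ### Types of elements and types of modules -/

section PretypeModules

/-- The dimensions of `F j ^ k • M` for the direct sum `M` of the modules `M_lam(F j')`. -/
def partitionType (lam : IntPartition) (e : ℕ) (same : Prop) [Decidable same] (k : ℕ) : ℕ :=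
  ∑ s : lam.2.parts, if same then e * (s.1 - k) else e * s.1

open scoped Classical in
/-- The type of the modules described by a pretype. -/
noncomputable def Pretype.moduleType {r : ℕ} {n : Fin r → ℕ} (P : Pretype n) (i : Fin r) :
    P.Q → ℕ → ℕ :=
  fun j k => ∑ j', partitionType (P.part i j') (P.deg j') (j = j') k

theorem Pretype.moduleType_zero {r : ℕ} {n : Fin r → ℕ} (P : Pretype n) (i : Fin r) (j : P.Q) :
    P.moduleType i j 0 = n i := by
  rw [← P.sum_eq i]
  refine Finset.sum_congr rfl fun j' _ => ?_
  simp only [partitionType, Nat.sub_zero, ite_self]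
  rw [← Finset.mul_sum]
  congr 1
  conv_rhs => rw [← (P.part i j').2.parts_sum]
  exact (Multiset.sum_eq_sum_coe _).symm

theorem Pretype.Iso.moduleType_eq {r : ℕ} {n : Fin r → ℕ} {P P' : Pretype n} {f : P.Q ≃ P'.Q}
    (h1 : ∀ j, P'.deg (f j) = P.deg j) (h2 : ∀ i j, P'.part i (f j) = P.part i j) (i : Fin r)
    (j : P.Q) (k : ℕ) : P'.moduleType i (f j) k = P.moduleType i j k := by
  unfold Pretype.moduleType
  rw [← f.sum_comp]
  refine Finset.sum_congr rfl fun j' _ => ?_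
  rw [h1, h2]
  exact Finset.sum_congr rfl fun s _ => by classical exact if_congr f.injective.eq_iff rfl rfl

variable {r : ℕ} {n : Fin r → ℕ} {K : Type u} [Field K]

theorem IsPrimeFamily.of_monic {Q : Type*} {F : Q → K[X]} {e : Q → ℕ} (hF : Function.Injective F)
    (h : ∀ j, (F j).Monic ∧ Irreducible (F j) ∧ (F j).natDegree = e j) : IsPrimeFamily F e where
  irreducible j := (h j).2.1
  natDegree_eq j := (h j).2.2
  isCoprime i j hij := by
    rw [(h i).2.1.coprime_iff_not_dvd]
    intro hdvd
    exact hij (hF (eq_of_monic_of_associated (h i).1 (h j).1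
      ((h i).2.1.associated_of_dvd (h j).2.1 hdvd)))

theorem Pretype.describes_module {P : Pretype n} {F : P.Q → K[X]} (hF : IsPrimeFamily F P.deg)
    (i : Fin r) {M : Type*} [AddCommGroup M] [Module K M] [Module K[X] M] [IsScalarTower K K[X] M]
    (g : M ≃ₗ[K[X]] ⨁ j, PartitionModule (P.part i j) (F j)) :
    IsSupported F M ∧ relType F (⊥ : Submodule K[X] M) ⊤ = P.moduleType i := by
  classical
  let Y : ∀ j, (P.part i j).2.parts → Type u := fun j s => K[X] ⧸ Ideal.span {F j ^ s.1}
  let g' : M ≃ₗ[K[X]] ∀ j, ∀ s, Y j s :=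
    (g.trans (DirectSum.linearEquivFunOnFintype K[X] P.Q fun j =>
      PartitionModule (P.part i j) (F j))).trans
    (LinearEquiv.piCongrRight fun j => DirectSum.linearEquivFunOnFintype K[X] _ (Y j))
  constructor
  · refine IsSupported.of_injective g'.toLinearMap g'.injective
      ⟨∑ j, (P.part i j).1, fun x => ?_⟩
    funext j s
    refine smul_quotient_span_singleton_eq_zero ?_ (x j s)
    refine (pow_dvd_pow (F j) (?_ : s.1 ≤ ∑ j, (P.part i j).1)).trans
      (pow_dvd_pow_of_dvd (Finset.dvd_prod_of_mem F (Finset.mem_univ j)) _)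
    refine le_trans ?_ (Finset.single_le_sum (f := fun j => (P.part i j).1)
      (fun _ _ => Nat.zero_le _) (Finset.mem_univ j))
    have := Multiset.single_le_sum (s := (P.part i j).2.parts) (fun _ _ => Nat.zero_le _) s.1
      (Multiset.coe_mem)
    rwa [(P.part i j).2.parts_sum] at this
  · have hfin : ∀ j s, Module.Finite K (Y j s) :=
      fun j s => finite_quotient_span_singleton (pow_ne_zero _ (hF.irreducible j).ne_zero)
    rw [relType_bot_top_of_linearEquiv F g']
    funext j k
    rw [relType_pi]
    refine Finset.sum_congr rfl fun j' _ => ?_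
    rw [relType_pi]
    refine Finset.sum_congr rfl fun s _ => ?_
    exact relType_cyclic hF j' j k s.1

/-- The type of `g` is witnessed by a pretype that is only isomorphic to `P`; reindexing its
polynomials gives one family on `P.Q` serving all components of `g`. -/
theorem exists_primeFamily_of_hasType (P : Pretype n) {g : GLTuple n K}
    (h : HasType g (Quotient.mk (Pretype.setoid n) P)) : ∃ F : P.Q → K[X], IsPrimeFamily F P.deg ∧
      ∀ i, IsSupported F (Module.AEval' (g i : Module.End K (Fin (n i) → K))) ∧
        relType F (⊥ : Submodule K[X] (Module.AEval' (g i : Module.End K (Fin (n i) → K)))) ⊤ =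
          P.moduleType i := by
  obtain ⟨P', hP, F, hinj, hF, hiso⟩ := h
  obtain ⟨f, h1, h2⟩ : Pretype.Iso P P' := Setoid.symm (Quotient.exact hP)
  have hF' := IsPrimeFamily.of_monic hinj hF
  refine ⟨F ∘ f, ⟨fun j => hF'.irreducible _, fun j => (hF'.natDegree_eq _).trans (h1 j),
    fun i j hij => hF'.isCoprime _ _ (f.injective.ne hij)⟩, fun i => ?_⟩
  obtain ⟨hsupp, ht⟩ := Pretype.describes_module hF' i (hiso i).some
  constructor
  · obtain ⟨N, hN⟩ := hsupp
    refine ⟨N, fun x => ?_⟩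
    rw [← hN x, ← f.prod_comp]
    rfl
  · funext j k
    rw [← Pretype.Iso.moduleType_eq h1 h2, ← ht]
    rfl

end PretypeModules

/-! ### Conjugacy as isomorphism of `K[X]`-modules -/

section Conjugacy

theorem isConj_pi_iff {ι : Type*} {G : ι → Type*} [∀ i, Group (G i)] (x y : ∀ i, G i) :
    IsConj x y ↔ ∀ i, IsConj (x i) (y i) := by
  simp only [isConj_iff]
  constructor
  · rintro ⟨c, rfl⟩ i
    exact ⟨c i, rfl⟩
  · intro h
    choose c hc using h
    exact ⟨c, funext hc⟩

variable {K : Type*} [Field K] {V V' : Type*} [AddCommGroup V] [Module K V] [AddCommGroup V']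
  [Module K V']

theorem nonempty_aeval_equiv_iff (f : Module.End K V) (f' : Module.End K V') :
    Nonempty (Module.AEval' f ≃ₗ[K[X]] Module.AEval' f') ↔
      ∃ h : V ≃ₗ[K] V', ∀ x, h (f x) = f' (h x) := by
  rw [← (equivTransportX (M := Module.AEval' f') f).nonempty_congr]
  constructor
  · rintro ⟨h, rfl⟩
    exact ⟨h.trans (Module.AEval'.of f').symm, fun x => by
      simp only [LinearEquiv.trans_apply, apply_transportX]
      obtain ⟨y, hy⟩ := (Module.AEval'.of f').surjective (h x)
      rw [← hy, Module.AEval'.X_smul_of]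
      simp⟩
  · rintro ⟨h, hh⟩
    refine ⟨h.trans (Module.AEval'.of f'), ?_⟩
    ext x
    apply (h.trans (Module.AEval'.of f')).injective
    rw [apply_transportX]
    simp [Module.AEval'.X_smul_of, hh]

theorem isConj_congrLinearEquiv_iff (e : V ≃ₗ[K] V') (a : LinearMap.GeneralLinearGroup K V')
    (s : LinearMap.GeneralLinearGroup K V) :
    IsConj a (LinearMap.GeneralLinearGroup.congrLinearEquiv e s) ↔
      Nonempty (Module.AEval' (s : Module.End K V) ≃ₗ[K[X]] Module.AEval' (a : Module.End K V')) := by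
  rw [nonempty_aeval_equiv_iff, isConj_iff]
  constructor
  · rintro ⟨c, hc⟩
    rw [mul_inv_eq_iff_eq_mul] at hc
    let c' := LinearMap.GeneralLinearGroup.toLinearEquiv c
    refine ⟨e.trans c'.symm, fun x => c'.injective ?_⟩
    have h1 := LinearMap.congr_fun (congrArg Units.val hc) (c'.symm (e x))
    change c' ((a : Module.End K V') (c'.symm (e x))) =
      e ((s : Module.End K V) (e.symm (c' (c'.symm (e x))))) at h1
    rw [LinearEquiv.apply_symm_apply, LinearEquiv.symm_apply_apply] at h1
    rw [LinearEquiv.trans_apply, LinearEquiv.apply_symm_apply, LinearEquiv.trans_apply, h1]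
  · rintro ⟨h, hh⟩
    refine ⟨LinearMap.GeneralLinearGroup.ofLinearEquiv (h.symm.trans e), ?_⟩
    rw [mul_inv_eq_iff_eq_mul]
    ext x
    change e (h.symm ((a : Module.End K V') x)) =
      e ((s : Module.End K V) (e.symm (e (h.symm x))))
    obtain ⟨y, rfl⟩ := h.surjective x
    rw [← hh, LinearEquiv.symm_apply_apply, LinearEquiv.symm_apply_apply,
      LinearEquiv.symm_apply_apply]

theorem isConj_iff_nonempty_aeval_equiv (a s : LinearMap.GeneralLinearGroup K V) :
    IsConj a s ↔
      Nonempty (Module.AEval' (s : Module.End K V) ≃ₗ[K[X]] Module.AEval' (a : Module.End K V)) :=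
  isConj_congrLinearEquiv_iff (LinearEquiv.refl K V) a s

end Conjugacy

/-! ### Classes meeting the parabolic subgroup -/

section Parabolic

namespace DimFlag

variable {K V : Type*} [Field K] [AddCommGroup V] [Module K V] [FiniteDimensional K V] {l : ℕ}
  {d : Fin l → ℕ}

theorem finrank_succ (𝓤 : DimFlag K V d) (i : Fin l) :
    Module.finrank K (𝓤.U i.succ) = Module.finrank K (𝓤.U i.castSucc) + d i := by
  rw [← 𝓤.finrank_step i, ← (Submodule.submoduleOfEquivOfLe (𝓤.le i)).finrank_eq, add_comm,
    Submodule.finrank_quotient_add_finrank]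

/-- The `K[X]`-module given by the action of `p` on `U_i / U_{i-1}` as a subquotient of the one
given by `p`. -/
noncomputable def stepEquiv (𝓤 : DimFlag K V d) (p : parabolic 𝓤.U) (i : Fin l) :
    (stableSubmodule (p.1 : Module.End K V) (𝓤.U i.succ) (p.2 _) ⧸
      (stableSubmodule (p.1 : Module.End K V) (𝓤.U i.castSucc) (p.2 _)).submoduleOf
        (stableSubmodule (p.1 : Module.End K V) (𝓤.U i.succ) (p.2 _))) ≃ₗ[K[X]]
      Module.AEval' (𝓤.stepAction i p : Module.End K (𝓤.Step i)) :=
  let W := stableSubmodule (p.1 : Module.End K V) (𝓤.U i.succ) (p.2 _)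
  let W' := stableSubmodule (p.1 : Module.End K V) (𝓤.U i.castSucc) (p.2 _)
  let s : Module.End K (𝓤.Step i) := 𝓤.stepAction i p
  let r : W →ₗ[K] 𝓤.U i.succ :=
    ((Module.AEval'.of (p.1 : Module.End K V)).symm.toLinearMap ∘ₗ
      W.subtype.restrictScalars K).codRestrict (𝓤.U i.succ) fun x => x.2
  let g : W →ₗ[K] Module.AEval' s :=
    (Module.AEval'.of s).toLinearMap ∘ₗ Submodule.mkQ _ ∘ₗ r
  have hX : ∀ x, g ((X : K[X]) • x) = (X : K[X]) • g x := by
    rintro ⟨x, hx⟩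
    obtain ⟨v, rfl⟩ := (Module.AEval'.of (p.1 : Module.End K V)).surjective x
    refine Eq.trans ?_ (Module.AEval'.X_smul_of s _).symm
    refine congrArg (Module.AEval'.of s) (congrArg (Submodule.mkQ _) (Subtype.ext ?_))
    change (Module.AEval'.of (p.1 : Module.End K V)).symm ((X : K[X]) • Module.AEval'.of _ v) = _
    rw [Module.AEval'.X_smul_of]
    rfl
  let G : W →ₗ[K[X]] Module.AEval' s :=
    { g with map_smul' := fun q x => map_polynomial_smul g hX q x }
  have hker : W'.submoduleOf W = LinearMap.ker G := by
    ext x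
    rw [LinearMap.mem_ker]
    change (Module.AEval'.of (p.1 : Module.End K V)).symm x.1 ∈ 𝓤.U i.castSucc ↔
      Module.AEval'.of s (Submodule.mkQ _ (r x)) = 0
    rw [LinearEquiv.map_eq_zero_iff, Submodule.mkQ_apply, Submodule.Quotient.mk_eq_zero]
    rfl
  have hsurj : Function.Surjective G := by
    intro y
    obtain ⟨y, rfl⟩ := (Module.AEval'.of s).surjective y
    obtain ⟨v, rfl⟩ := Submodule.mkQ_surjective _ y
    exact ⟨⟨Module.AEval'.of _ v.1, of_mem_stableSubmodule.mpr v.2⟩, rfl⟩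
  (Submodule.quotEquivOfEq _ _ hker).trans (G.quotKerEquivOfSurjective hsurj)

end DimFlag

variable {K : Type u} [Field K] {l : ℕ} {d : Fin l → ℕ}

theorem isConj_embedding_iff (𝓤 : DimFlag K (Fin (∑ i, d i) → K) d)
    (ε : ∀ i, 𝓤.Step i ≃ₗ[K] (Fin (d i) → K)) (g : GLTuple (flagDims d) K) (p : parabolic 𝓤.U) :
    IsConj g (𝓤.embedding ε p) ↔
      Nonempty (Module.AEval' (p.1 : Module.End K (Fin (∑ i, d i) → K)) ≃ₗ[K[X]]
        Module.AEval' (g 0 : Module.End K (Fin (flagDims d 0) → K))) ∧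
      ∀ i : Fin l, Nonempty (Module.AEval' (𝓤.stepAction i p : Module.End K (𝓤.Step i)) ≃ₗ[K[X]]
        Module.AEval' (g i.succ : Module.End K (Fin (flagDims d i.succ) → K))) := by
  rw [isConj_pi_iff, Fin.forall_fin_succ]
  refine and_congr ?_ (forall_congr' fun i => ?_)
  · exact isConj_iff_nonempty_aeval_equiv _ _
  · exact isConj_congrLinearEquiv_iff (ε i) _ _

variable [Finite K]

/-- The step action is a subquotient of the module of `p`, and supported modules of equal dimension
are isomorphic when their types agree. Conjugacy on the quotients thus becomes a condition on types.
-/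
theorem nonempty_stepAction_iff {Q : Type} [Fintype Q] {e : Q → ℕ} {F : Q → K[X]}
    (he : ∀ j, 0 < e j) (hF : IsPrimeFamily F e) (𝓤 : DimFlag K (Fin (∑ i, d i) → K) d)
    (p : parabolic 𝓤.U) (i : Fin l) (a : Module.End K (Fin (d i) → K))
    (hp : IsSupported F (Module.AEval' (p.1 : Module.End K (Fin (∑ i, d i) → K)))) :
    Nonempty (Module.AEval' (𝓤.stepAction i p : Module.End K (𝓤.Step i)) ≃ₗ[K[X]]
        Module.AEval' a) ↔
      relType F
        (stableSubmodule (p.1 : Module.End K (Fin (∑ i, d i) → K)) (𝓤.U i.castSucc) (p.2 _))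
        (stableSubmodule (p.1 : Module.End K (Fin (∑ i, d i) → K)) (𝓤.U i.succ) (p.2 _)) =
      relType F (⊥ : Submodule K[X] (Module.AEval' a)) ⊤ := by
  have htype : relType F
      (⊥ : Submodule K[X] (Module.AEval' (𝓤.stepAction i p : Module.End K (𝓤.Step i)))) ⊤ =
      relType F
        (stableSubmodule (p.1 : Module.End K (Fin (∑ i, d i) → K)) (𝓤.U i.castSucc) (p.2 _))
        (stableSubmodule (p.1 : Module.End K (Fin (∑ i, d i) → K)) (𝓤.U i.succ) (p.2 _)) := by
    rw [← relType_bot_top_of_linearEquiv F (𝓤.stepEquiv p i)]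
    exact relType_subquotient F fun x hx => 𝓤.le i hx
  rw [← htype]
  constructor
  · rintro ⟨h⟩
    exact relType_bot_top_of_linearEquiv F h
  · refine nonempty_linearEquiv_of_relType_eq he hF ?_ ?_
    · exact ((hp.of_injective (Submodule.subtype _) (Submodule.injective_subtype _)).of_surjective
        (Submodule.mkQ _) (Submodule.mkQ_surjective _)).of_injective
        (𝓤.stepEquiv p i).symm.toLinearMap (𝓤.stepEquiv p i).symm.injective
    · rw [← (Module.AEval'.of _).finrank_eq, ← (Module.AEval'.of a).finrank_eq, 𝓤.finrank_step,
        Module.finrank_fin_fun]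

theorem ncard_class_inter_imageJ {Q : Type} [Fintype Q] {e : Q → ℕ} {F : Q → K[X]}
    (he : ∀ j, 0 < e j) (hF : IsPrimeFamily F e) (𝓤 : DimFlag K (Fin (∑ i, d i) → K) d)
    (ε : ∀ i, 𝓤.Step i ≃ₗ[K] (Fin (d i) → K)) (g : GLTuple (flagDims d) K)
    (hg : IsSupported F (Module.AEval' (g 0 : Module.End K (Fin (flagDims d 0) → K)))) :
    ((ConjClasses.mk g).carrier ∩ (𝓤.imageJ ε : Set (GLTuple (flagDims d) K))).ncard =
      Nat.card {p : Module.End K (Fin (∑ i, d i) → K) //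
        Nonempty (Module.AEval' p ≃ₗ[K[X]]
          Module.AEval' (g 0 : Module.End K (Fin (flagDims d 0) → K))) ∧
        CarriesToTypedFlag F (fun i => relType F (⊥ : Submodule K[X]
          (Module.AEval' (g i.succ : Module.End K (Fin (flagDims d i.succ) → K)))) ⊤) 𝓤.U
          (Module.AEval'.of p)} := by
  have key : ∀ p : parabolic 𝓤.U, IsConj g (𝓤.embedding ε p) ↔
      Nonempty (Module.AEval' (p.1 : Module.End K (Fin (∑ i, d i) → K)) ≃ₗ[K[X]]
        Module.AEval' (g 0 : Module.End K (Fin (flagDims d 0) → K))) ∧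
      CarriesToTypedFlag F (fun i => relType F (⊥ : Submodule K[X]
          (Module.AEval' (g i.succ : Module.End K (Fin (flagDims d i.succ) → K)))) ⊤) 𝓤.U
          (Module.AEval'.of (p.1 : Module.End K (Fin (∑ i, d i) → K))) := by
    intro p
    rw [isConj_embedding_iff, carriesToTypedFlag_of_iff 𝓤.bot 𝓤.top 𝓤.le]
    refine and_congr_right fun ⟨h⟩ => ?_
    have hp := hg.of_injective h.toLinearMap h.injective
    refine (forall_congr' fun i => nonempty_stepAction_iff he hF 𝓤 p i _ hp).trans ?_
    exact ⟨fun h => ⟨p.2, h⟩, fun ⟨_, h⟩ => h⟩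
  rw [← Nat.card_coe_set_eq]
  symm
  -- The count runs over endomorphisms, but similarity to the invertible `g 0` makes each of them
  -- invertible.
  have hunit : ∀ p : Module.End K (Fin (∑ i, d i) → K), Nonempty (Module.AEval' p ≃ₗ[K[X]]
      Module.AEval' (g 0 : Module.End K (Fin (flagDims d 0) → K))) → IsUnit p := by
    rintro p h
    obtain ⟨h, hh⟩ := (nonempty_aeval_equiv_iff _ _).mp h
    rw [Module.End.isUnit_iff]
    have : (p : (Fin (∑ i, d i) → K) → _) = h.symm ∘
        (LinearMap.GeneralLinearGroup.toLinearEquiv (g 0)) ∘ h := by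
      funext x
      exact h.injective ((hh x).trans (h.apply_symm_apply _).symm)
    rw [this]
    exact h.symm.bijective.comp ((LinearEquiv.bijective _).comp h.bijective)
  refine Nat.card_congr (Equiv.ofBijective (fun p => ⟨𝓤.embedding ε ⟨(hunit p.1 p.2.1).unit,
    ((carriesToTypedFlag_of_iff 𝓤.bot 𝓤.top 𝓤.le p.1).mp p.2.2).choose⟩, ?_, ⟨_, rfl⟩⟩)
    ⟨?_, ?_⟩)
  · rw [ConjClasses.mem_carrier_iff_mk_eq, eq_comm, ConjClasses.mk_eq_mk_iff_isConj, key]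
    exact p.2
  -- The component 0 of the embedding is `p` itself.
  · rintro ⟨p, hp⟩ ⟨p', hp'⟩ h
    exact Subtype.ext (congrArg Units.val (congrFun (congrArg Subtype.val h) 0))
  · rintro ⟨_, hx, p, rfl⟩
    rw [ConjClasses.mem_carrier_iff_mk_eq, eq_comm, ConjClasses.mk_eq_mk_iff_isConj, key] at hx
    exact ⟨⟨_, hx⟩, Subtype.ext (congrArg (𝓤.embedding ε) (Subtype.ext (Units.ext rfl)))⟩

end Parabolic

theorem mainTheorem6 {l : ℕ} (d : Fin l → ℕ) (hd : ∀ i, 0 < d i)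
    (𝓤 : ∀ (K : Type u) [Field K] [Finite K], DimFlag K (Fin (∑ i, d i) → K) d)
    (e : ∀ (K : Type u) [Field K] [Finite K] (i : Fin l),
      (𝓤 K).Step i ≃ₗ[K] (Fin (d i) → K)) :
    IsUniformFamily (flagDims d) (fun (K : Type u) [Field K] [Finite K] =>
      (𝓤 K).imageJ (e K)) := by
  intro T
  obtain ⟨P, rfl⟩ := Quotient.exists_rep T
  have hb : ∀ i : Fin l, ∃ j, P.moduleType i.succ j 0 = d i := by
    intro i
    -- Positivity of `d i` rules out an empty `Q`, so the types do determine the dimensions of the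
    -- steps.
    have hQ : Nonempty P.Q := by
      by_contra h
      rw [not_nonempty_iff] at h
      have := P.sum_eq i.succ
      rw [Finset.univ_eq_empty, Finset.sum_empty] at this
      exact (hd i).ne this
    exact ⟨hQ.some, P.moduleType_zero i.succ _⟩
  obtain ⟨α, β, ⟨A₁, B₁, h₁⟩, ⟨A₂, B₂, h₂⟩, h⟩ := card_flag_endomorphisms_rational.{u} P.deg_pos d
    (∑ i, d i) (P.moduleType 0) (fun i => P.moduleType i.succ) hb
  have main : ∀ (K : Type u) [Field K] [Finite K] (C : ConjClasses (GLTuple (flagDims d) K)),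
      IsClassOfType C (Quotient.mk (Pretype.setoid _) P) →
        β (Nat.card K) ≠ 0 ∧
        ((C.carrier ∩ ((𝓤 K).imageJ (e K) : Set (GLTuple (flagDims d) K))).ncard : ℚ) *
          β (Nat.card K) = α (Nat.card K) := by
    rintro K _ _ C ⟨g, hgC, hgT⟩
    obtain ⟨F, hF, hg⟩ := exists_primeFamily_of_hasType P hgT
    obtain rfl := ConjClasses.mem_carrier_iff_mk_eq.mp hgC
    rw [ncard_class_inter_imageJ P.deg_pos hF (𝓤 K) (e K) g (hg 0).1]
    have hsucc : (fun i : Fin l => relType F (⊥ : Submodule K[X]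
        (Module.AEval' (g i.succ : Module.End K (Fin (flagDims d i.succ) → K)))) ⊤) =
        fun i => P.moduleType i.succ := funext fun i => (hg i.succ).2
    rw [hsucc]
    exact h K F hF _ (𝓤 K).U (𝓤 K).bot (𝓤 K).le (𝓤 K).finrank_succ (𝓤 K).top
      (Module.finrank_fin_fun K) _ (hg 0).1
      ((Module.AEval'.of _).finrank_eq.symm.trans (Module.finrank_fin_fun K)) (hg 0).2
  have main' : ∀ (K : Type u) [Field K] [Finite K] (C : ConjClasses (GLTuple (flagDims d) K)),
      IsClassOfType C (Quotient.mk (Pretype.setoid _) P) →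
        (A₂ * B₁).eval (Nat.card K : ℚ) ≠ 0 ∧
        ((C.carrier ∩ ((𝓤 K).imageJ (e K) : Set (GLTuple (flagDims d) K))).ncard : ℚ) *
          (A₂ * B₁).eval (Nat.card K : ℚ) = (A₁ * B₂).eval (Nat.card K : ℚ) := by
    intro K _ _ C hC
    obtain ⟨hβ, heq⟩ := main K C hC
    obtain ⟨k₁, k₁'⟩ := h₁ (Nat.card K) Finite.one_lt_card
    obtain ⟨k₂, k₂'⟩ := h₂ (Nat.card K) Finite.one_lt_card
    rw [eval_mul, eval_mul, ← k₂', ← k₁', ← heq]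
    exact ⟨mul_ne_zero (mul_ne_zero hβ k₂) k₁, by ring⟩
  -- The quotient is integral at every `q` over which the type occurs, since it is a cardinality
  -- there.
  obtain ⟨R, hR⟩ := exists_polynomial_of_integral_quotient (A₁ * B₂) (A₂ * B₁)
    {q | ∃ (K : Type u) (_ : Field K) (_ : Finite K) (C : ConjClasses (GLTuple (flagDims d) K)),
      IsClassOfType C (Quotient.mk (Pretype.setoid _) P) ∧ Nat.card K = q} (by
    rintro q ⟨K, _, _, C, hC, rfl⟩
    obtain ⟨k, k'⟩ := main' K C hC
    exact ⟨k, _, by rw [← k', Int.cast_natCast]⟩)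
  refine ⟨R, fun K _ _ C hC => ?_⟩
  obtain ⟨k, k'⟩ := main' K C hC
  exact mul_right_cancel₀ k (k'.trans (hR _ ⟨K, ‹_›, ‹_›, C, hC, rfl⟩).symm)
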